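/- **Maximal symmetry of polyhedral embeddings of the Fricke–Klein map.** A *polyhedron* $P$ is a compact closed connected surface in Euclidean 3-space $\mathbb{E}^3$ made up of finitely many convex polygons (its faces), any two of which intersect, if at all, in a common vertex or a common edge, and such that no two adjacent faces (faces sharing an edge) are coplanar. Its *symmetry group* $G(P)$ consists of all isometries of $\mathbb{E}^3$ that permute the faces of $P$. The *Fricke–Klein map* is the regular map of type $\{3,8\}$ on the orientable surface of genus $5$, with 24 vertices, 96 edges and 64 triangular faces. Explicitly, its faces are the triangles with vertex sets the images of $$\{(1,2,6),(2,6,1),(6,1,2)\},\quad \{(1,2,6),(2,6,1),(-2,1,6)\},$$ $$\{(2,-1,6),(-1,6,2),(6,2,-1)\},\quad \{(2,-1,6),(-1,6,2),(-2,6,-1)\}$$ under the 24 signed permutations of coordinates of determinant $1$ (the points serving only as labels of the vertices). A *polyhedral embedding* of the map is a polyhedron whose vertices correspond bijectively to the vertices of the map in such a way that the vertex sets of its faces are exactly those of the faces of the map. Let $O$ and $O_h$ be the octahedral rotation group (order 24) and the full octahedral group (order 48), i.e. the group of rotations and the group of all isometries preserving the regular octahedron with vertices $\pm e_1,\pm e_2,\pm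 e_3$. Then: 1. There is a polyhedral embedding $P$ of the Fricke–Klein map in $\mathbb{E}^3$ with $G(P)=O$. 2. $O$ has order 24, and for every polyhedral embedding $P'$ of the Fricke–Klein map the group $G(P')$ is finite of order at most $24$. So octahedral rotation symmetry is the largest possible. 3. No polyhedral embedding of the Fricke–Klein map has full octahedral symmetry: $G(P')$ never contains a conjugate $hO_hh^{-1}$, $h$ an isometry of $\mathbb{E}^3$. 4. In particular, no polyhedral embedding $P'$ with $hO_hh^{-1}\le G(P')$ has as vertex set the image under $h$ of one of the following sets, where $0<a<b$: the $O_h$-orbit of $(a,b,b)$ (truncated cube), of $(0,a,b)$ (truncated octahedron), of $(a,a,b)$ (rhombicuboctahedron), or the union of the $O_h$-orbits of $(0,a,a)$ and $(0,b,b)$ (two concentric cuboctahedra). -/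

import Mathlib

/-- Euclidean 3-space. -/
abbrev E3 : Type := EuclideanSpace ℝ (Fin 3)

/-- The group of isometries of Euclidean 3-space (translations are allowed). -/
abbrev Isom3 : Type := E3 ≃ᵃⁱ[ℝ] E3

/-! ### Polyhedra -/

/-- A (nondegenerate) convex polygon: the convex hull of finitely many points, of dimension 2. -/
def IsConvexPolygon (F : Set E3) : Prop :=
  (∃ s : Set E3, s.Finite ∧ F = convexHull ℝ s) ∧ Module.finrank ℝ (vectorSpan ℝ F) = 2

/-- The vertices of a convex polygon are its extreme points. -/
def polygonVertices (F : Set E3) : Set E3 := F.extremePoints ℝ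

/-- The edges of a convex polygon are its one-dimensional faces: the nondegenerate segments
that are extreme subsets of it. -/
def IsPolygonEdge (e F : Set E3) : Prop :=
  (∃ u v : E3, u ≠ v ∧ e = segment ℝ u v) ∧ IsExtreme ℝ F e

/-- A polyhedron: a compact closed (connected) surface in Euclidean 3-space made up of finitely
many convex polygons, any two of which meet, if at all, in a common vertex or a common edge,
and such that adjacent faces are not coplanar.
That the union of the faces is a closed connected surface is expressed by the conditions
`existsUnique_adj` (every edge lies in exactly two faces), `vertex_link` (the faces at a vertex
form a single cycle around it) and `connected`. -/
structure Polyhedron where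
  /-- the faces, as subsets of space -/
  faces : Set (Set E3)
  faces_finite : faces.Finite
  faces_nonempty : faces.Nonempty
  isConvexPolygon : ∀ F ∈ faces, IsConvexPolygon F
  inter : ∀ F ∈ faces, ∀ G ∈ faces, F ≠ G →
    F ∩ G = ∅ ∨
    (∃ v, v ∈ polygonVertices F ∧ v ∈ polygonVertices G ∧ F ∩ G = {v}) ∨
    (IsPolygonEdge (F ∩ G) F ∧ IsPolygonEdge (F ∩ G) G)
  existsUnique_adj : ∀ F ∈ faces, ∀ e, IsPolygonEdge e F →
    ∃! G, G ∈ faces ∧ G ≠ F ∧ IsPolygonEdge e G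
  vertex_link : ∀ v : E3, ∀ F ∈ faces, ∀ G ∈ faces,
    v ∈ polygonVertices F → v ∈ polygonVertices G →
      Relation.ReflTransGen
        (fun A B => A ∈ faces ∧ B ∈ faces ∧ ∃ e, v ∈ e ∧ IsPolygonEdge e A ∧ IsPolygonEdge e B)
        F G
  connected : ∀ F ∈ faces, ∀ G ∈ faces,
      Relation.ReflTransGen
        (fun A B => A ∈ faces ∧ B ∈ faces ∧ ∃ e, IsPolygonEdge e A ∧ IsPolygonEdge e B)
        F G
  not_coplanar : ∀ F ∈ faces, ∀ G ∈ faces, F ≠ G →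
    (∃ e, IsPolygonEdge e F ∧ IsPolygonEdge e G) → ¬ Coplanar ℝ (F ∪ G)

namespace Polyhedron

/-- The vertices of a polyhedron are the vertices of its faces. -/
def vertices (P : Polyhedron) : Set E3 := {v | ∃ F ∈ P.faces, v ∈ polygonVertices F}

/-- The geometric symmetry group `G(P)`: the isometries of space that map `P` to itself, that is,
permute the faces of `P`. -/
def symmetryGroup (P : Polyhedron) : Subgroup Isom3 where
  carrier := {g | ∀ F : Set E3, g '' F ∈ P.faces ↔ F ∈ P.faces}
  one_mem' := by intro F; simp
  mul_mem' := by
    intro a b ha hb F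
    rw [← hb F, ← ha (b '' F), ← Set.image_comp]
    rfl
  inv_mem' := by
    intro a ha F
    rw [← ha (⇑(a⁻¹ : Isom3) '' F), ← Set.image_comp]
    have h : (⇑a ∘ ⇑(a⁻¹ : Isom3)) = id := by
      funext x
      exact a.apply_symm_apply x
    rw [h, Set.image_id]

/-- `P` is a polyhedral embedding of the map with triangular faces `K` (every face of the map is
given by its set of vertices): the vertices of the map correspond bijectively to the vertices of
`P`, in such a way that the vertex sets of the faces of the map correspond exactly to the vertex
sets of the faces of `P`. -/
def IsEmbeddingOf {V : Type*} (P : Polyhedron) (K : Set (Finset V)) : Prop :=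
  ∃ φ : V → E3,
    Set.InjOn φ {v | ∃ f ∈ K, v ∈ f} ∧
    polygonVertices '' P.faces = (fun f : Finset V => φ '' (f : Set V)) '' K

end Polyhedron

/-! ### The Fricke-Klein map -/

/-- Two triangles from each of the two shells; their 64 images under the 24 rotations of the
coordinate octahedron are the faces of the Fricke-Klein map, on 24 vertices. -/
def frickeKleinBase : Finset (Finset (Fin 3 → ℤ)) :=
  {{![1, 2, 6], ![2, 6, 1], ![6, 1, 2]},
   {![1, 2, 6], ![2, 6, 1], ![-2, 1, 6]},
   {![2, -1, 6], ![-1, 6, 2], ![6, 2, -1]},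
   {![2, -1, 6], ![-1, 6, 2], ![-2, 6, -1]}}

/-- The Fricke-Klein map, the regular map of type {3,8} and genus 5 (24 vertices, 96 edges,
64 triangular faces, 384 automorphisms), given by the vertex sets of its faces. Here the integer
points serve only as labels of the vertices. The pairs `(p, s)` with
`Equiv.Perm.sign p * ∏ i, s i = 1` are the signed coordinate permutations of determinant 1. -/
def frickeKleinMap : Set (Finset (Fin 3 → ℤ)) :=
  {f | ∃ (p : Equiv.Perm (Fin 3)) (s : Fin 3 → ℤˣ), Equiv.Perm.sign p * ∏ i, s i = 1 ∧
    ∃ t ∈ frickeKleinBase, f = t.image (fun v i => (s i : ℤ) * v (p i))}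

/-! ### Octahedral groups and their orbits -/

/-- The vertices `±eᵢ` of the coordinate regular octahedron. -/
def octahedronVertices : Set E3 :=
  {x | ∃ i : Fin 3, x = EuclideanSpace.single i 1 ∨ x = EuclideanSpace.single i (-1)}

/-- The full octahedral group (order 48): all isometries preserving the coordinate octahedron. -/
def fullOctahedralGroup : Subgroup Isom3 where
  carrier := {g | ∀ x : E3, g x ∈ octahedronVertices ↔ x ∈ octahedronVertices}
  one_mem' := by intro x; rfl
  mul_mem' := by
    intro a b ha hb x
    rw [← hb x, ← ha (b x)]
    rfl
  inv_mem' := by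
    intro a ha x
    rw [← ha (a⁻¹ x)]
    have h : a (a⁻¹ x) = x := a.apply_symm_apply x
    rw [h]

/-- The octahedral rotation group (order 24): the orientation preserving elements of the full
octahedral group. -/
def octahedralRotationGroup : Subgroup Isom3 where
  carrier := {g | g ∈ fullOctahedralGroup ∧ LinearMap.det (g.linearIsometryEquiv : E3 →ₗ[ℝ] E3) = 1}
  one_mem' := ⟨fullOctahedralGroup.one_mem, LinearMap.det_id⟩
  mul_mem' := by
    rintro a b ⟨ha, ha'⟩ ⟨hb, hb'⟩
    refine ⟨fullOctahedralGroup.mul_mem ha hb, ?_⟩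
    have h : (((a * b : Isom3).linearIsometryEquiv : E3 ≃ₗᵢ[ℝ] E3) : E3 →ₗ[ℝ] E3) =
        (a.linearIsometryEquiv : E3 →ₗ[ℝ] E3) ∘ₗ (b.linearIsometryEquiv : E3 →ₗ[ℝ] E3) := rfl
    rw [h, LinearMap.det_comp, ha', hb', one_mul]
  inv_mem' := by
    rintro a ⟨ha, ha'⟩
    refine ⟨fullOctahedralGroup.inv_mem ha, ?_⟩
    have h : (a.linearIsometryEquiv : E3 →ₗ[ℝ] E3) ∘ₗ
        (((a⁻¹ : Isom3).linearIsometryEquiv : E3 ≃ₗᵢ[ℝ] E3) : E3 →ₗ[ℝ] E3) = LinearMap.id := by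
      apply LinearMap.ext
      intro x
      exact a.linearIsometryEquiv.apply_symm_apply x
    have h2 := congrArg LinearMap.det h
    rwa [LinearMap.det_comp, ha', one_mul, LinearMap.det_id] at h2

/-- The conjugate of the full octahedral group by the isometry `h`: the full symmetry group of the
regular octahedron that is the image under `h` of the coordinate octahedron. -/
noncomputable def fullOctahedralGroupAt (h : Isom3) : Subgroup Isom3 :=
  fullOctahedralGroup.map (MulAut.conj h).toMonoidHom

/-- The orbit of the point `(a, b, c)` under the full octahedral group. -/
def octahedralOrbit (a b c : ℝ) : Set E3 :=
  {x | ∃ g ∈ fullOctahedralGroup, x = g !₂[a, b, c]}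

/-- `S` is the vertex set of a truncated cube, a truncated octahedron or a rhombicuboctahedron
(not necessarily with regular faces), or of two concentric homothetic cuboctahedra, each in
standard position with respect to the coordinate octahedron. -/
def IsCandidateVertexSet (S : Set E3) : Prop :=
  ∃ a b : ℝ, 0 < a ∧ a < b ∧
    (S = octahedralOrbit a b b ∨ S = octahedralOrbit 0 a b ∨ S = octahedralOrbit a a b ∨
      S = octahedralOrbit 0 a a ∪ octahedralOrbit 0 b b)

/-! An automorphism of the map is determined by its values on one face, so there are at most 384 of
them (`card_automorphisms_le`). A symmetry of a polyhedral embedding permutes the 24 vertices as an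
automorphism, and it does so faithfully because two adjacent faces are not coplanar. Let `G` be the
induced group. To prove that its order is at most 24 it suffices to exhibit 16 automorphisms in
different cosets of `G` (`card_mul_length_le`).

The proof turns on the three half-turns around vertices, each of which fixes eight vertices. If `G`
contains none of them, the bound is group theory (`card_le_of_halfTurn_notMem`). There are three
cases: `G` contains the involution `central`, or one of the listed reflections, or neither. Each
case has its own 16 automorphisms, and if the quotient of two of them were in `G`, then `G` would
contain a half-turn or another element excluded in that case.

If `G` contains a half-turn, geometry enters. Were its eight fixed points not collinear, the
isometry would act on the neighbours of a fixed vertex as a reflection in a plane. An edge of the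
link that crosses this plane would then meet the opposite edge of the link, although the two faces
share only the vertex (`Realizes.collinear_axis`). So the eight points lie on a line. A symmetry
that fixes two of them fixes them all, and one that preserves the set cannot move an end point to an
inner point. This separates 16 cosets (`Realizes.card_le_of_extremal`).

For existence, the integer labels themselves are taken as vertices. Any two faces are separated by
an integer functional (`separatesUpToSign_tri`), and the rotations preserve the set of faces by its
definition. The bound 24 then makes the symmetry group equal to the rotation group. The full
octahedral group has more than 24 elements, which excludes it and hence all the candidate vertex
sets. -/

/-! ### The map on 24 numbered vertices -/

namespace FrickeKlein

/-- The vertices are numbered from `0` to `23`, so that every vertex but `0` has a neighbour with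
a smaller number. The 8 neighbours of every vertex, in cyclic order, are the digits of this number
in base 24. -/
def linkCode : ℕ :=
  6186272277237524389680585257136027749774475765804907307724744581114831575360980289024165775688675541837494159536806697680128725191283648144352179741076779563048093710941661344026664220241966671430404384545005104456178014880037279336254116767165214531993839430741745

/-- The `i`-th neighbour of the vertex `v`. -/
def link (v : Fin 24) (i : Fin 8) : Fin 24 :=
  Fin.ofNat 24 (linkCode.div (Nat.pow 24 (8 * v + i)))

/-- `v`, `a`, `b` are the three vertices of a face. -/
def Flag (v a b : Fin 24) : Prop :=
  ∃ i : Fin 8, (link v i = a ∧ link v (i + 1) = b) ∨ (link v (i + 1) = a ∧ link v i = b)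

instance (v a b : Fin 24) : Decidable (Flag v a b) := by unfold Flag; infer_instance

theorem link_injective (v : Fin 24) : Function.Injective (link v) := by
  intro i j
  revert v i j
  decide +kernel

theorem link_ne (v : Fin 24) (i : Fin 8) : link v i ≠ v := by
  revert v i
  decide +kernel

theorem flag_link (v : Fin 24) (i : Fin 8) : Flag v (link v i) (link v (i + 1)) :=
  ⟨i, Or.inl ⟨rfl, rfl⟩⟩

theorem Flag.swap {v a b : Fin 24} (h : Flag v a b) : Flag v b a := by
  obtain ⟨i, h | h⟩ := h
  · exact ⟨i, Or.inr ⟨h.2, h.1⟩⟩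
  · exact ⟨i, Or.inl ⟨h.2, h.1⟩⟩

/-- The table records every face in the links of all its three vertices. That these entries agree
makes `Flag` symmetric in its arguments. -/
theorem flag_rotate_link : ∀ (v : Fin 24) (i : Fin 8),
    Flag (link v i) (link v (i + 1)) v ∧ Flag (link v (i + 1)) (link v i) v := by
  decide +kernel

theorem Flag.rotate {v a b : Fin 24} (h : Flag v a b) : Flag a b v := by
  obtain ⟨i, ⟨rfl, rfl⟩ | ⟨rfl, rfl⟩⟩ := h
  · exact (flag_rotate_link v i).1
  · exact (flag_rotate_link v i).2

theorem Flag.ne {v a b : Fin 24} (h : Flag v a b) : v ≠ a ∧ v ≠ b ∧ a ≠ b := by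
  have key : ∀ {v a b : Fin 24}, Flag v a b → v ≠ a := by
    rintro v a b ⟨i, ⟨rfl, -⟩ | ⟨rfl, -⟩⟩
    · exact (link_ne v i).symm
    · exact (link_ne v (i + 1)).symm
  exact ⟨key h, key h.swap, key h.rotate⟩

/-- Every edge lies in exactly two faces, given by the neighbours of `link v i` in the cycle around
`v`. -/
theorem flag_link_iff {v b : Fin 24} {i : Fin 8} :
    Flag v (link v i) b ↔ b = link v (i + 1) ∨ b = link v (i - 1) := by
  constructor
  · rintro ⟨j, ⟨h, rfl⟩ | ⟨h, rfl⟩⟩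
    · rw [link_injective v h]; exact Or.inl rfl
    · rw [← link_injective v h]; simp
  · rintro (rfl | rfl)
    · exact flag_link v i
    · have := (flag_link v (i - 1)).swap
      simpa using this

/-- Connectedness of the map, in a form suited to induction on the number of a vertex. -/
theorem exists_link_lt : ∀ v : Fin 24, v ≠ 0 → ∃ i, link v i < v := by
  decide +kernel

theorem Flag.exists_link {v a b : Fin 24} (h : Flag v a b) : ∃ i, link v i = a := by
  obtain ⟨i, h | h⟩ := h
  · exact ⟨i, h.1⟩
  · exact ⟨i + 1, h.1⟩

/-- The automorphisms of the map. -/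
def automorphisms : Subgroup (Equiv.Perm (Fin 24)) where
  carrier := {π | ∀ v a b, Flag (π v) (π a) (π b) ↔ Flag v a b}
  one_mem' := fun _ _ _ => Iff.rfl
  mul_mem' := fun {_ _} hp hq v a b => (hp _ _ _).trans (hq v a b)
  inv_mem' := fun {p} hp v a b => by
    rw [← hp]; simp

/-- Reduces a condition on all triples of vertices to checks on the 192 entries of the table. -/
theorem mem_automorphisms_of_link {π : Equiv.Perm (Fin 24)}
    (h : ∀ v i, Flag (π v) (π (link v i)) (π (link v (i + 1))))
    (h' : ∀ v i, Flag (π⁻¹ v) (π⁻¹ (link v i)) (π⁻¹ (link v (i + 1)))) :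
    π ∈ automorphisms := by
  have key : ∀ σ : Equiv.Perm (Fin 24),
      (∀ v i, Flag (σ v) (σ (link v i)) (σ (link v (i + 1)))) →
      ∀ v a b, Flag v a b → Flag (σ v) (σ a) (σ b) := by
    rintro σ hσ v a b ⟨i, ⟨rfl, rfl⟩ | ⟨rfl, rfl⟩⟩
    · exact hσ v i
    · exact (hσ v i).swap
  intro v a b
  refine ⟨fun hf => ?_, key π h v a b⟩
  simpa using key π⁻¹ h' _ _ _ hf

/-- If one of the two faces at an edge is fixed pointwise, so is the other, and this propagates
around `v`. -/
theorem fixes_link {π : Equiv.Perm (Fin 24)} (hπ : π ∈ automorphisms) {v a b : Fin 24}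
    (hf : Flag v a b) (hv : π v = v) (ha : π a = a) (hb : π b = b) (i : Fin 8) :
    π (link v i) = link v i := by
  have step : ∀ j : Fin 8, π (link v j) = link v j → π (link v (j + 1)) = link v (j + 1) →
      π (link v (j + 1 + 1)) = link v (j + 1 + 1) := by
    intro j h0 h1
    have h := (hπ v _ _).2 (flag_link v (j + 1))
    rw [hv, h1, flag_link_iff] at h
    rcases h with h | h
    · exact h
    · rw [add_sub_cancel_right, ← h0] at h
      have := link_injective v (π.injective h)
      omega
  have all : ∀ j : Fin 8, π (link v j) = link v j → π (link v (j + 1)) = link v (j + 1) →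
      ∀ n : ℕ, π (link v (j + n • 1)) = link v (j + n • 1) ∧
        π (link v (j + n • 1 + 1)) = link v (j + n • 1 + 1) := by
    intro j h0 h1 n
    induction n with
    | zero => simpa using ⟨h0, h1⟩
    | succ n ih =>
      have := step _ ih.1 ih.2
      rw [succ_nsmul, ← add_assoc]
      exact ⟨ih.2, this⟩
  have hval : ∀ k : Fin 8, k.val • (1 : Fin 8) = k := by decide
  obtain ⟨j, ⟨rfl, rfl⟩ | ⟨rfl, rfl⟩⟩ := hf
  · have := (all j ha hb (i - j).val).1
    rwa [hval, add_sub_cancel] at this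
  · have := (all j hb ha (i - j).val).1
    rwa [hval, add_sub_cancel] at this

/-- An automorphism that fixes the three vertices of a face is the identity. -/
theorem eq_one_of_fixes_flag {π : Equiv.Perm (Fin 24)} (hπ : π ∈ automorphisms)
    {v a b : Fin 24} (hf : Flag v a b) (hv : π v = v) (ha : π a = a) (hb : π b = b) : π = 1 := by
  have spread : ∀ w : Fin 24, ∀ i : Fin 8, π w = w → (∀ k, π (link w k) = link w k) →
      ∀ k, π (link (link w i) k) = link (link w i) k := by
    intro w i hw hl
    exact fixes_link hπ (flag_rotate_link w i).1 (hl i) (hl (i + 1)) hw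
  have back : ∀ w i, ∃ k, link (link w i) k = w := fun w i =>
    (flag_rotate_link w i).1.swap.exists_link
  -- As an equivalence, this carries the property from the given `v` to `0` and from `0` to every
  -- vertex.
  have hall : ∀ w : Fin 24, (π w = w ∧ ∀ k, π (link w k) = link w k) ↔
      (π 0 = 0 ∧ ∀ k, π (link 0 k) = link 0 k) := by
    intro w
    induction w using WellFoundedLT.induction with
    | ind w ih =>
      by_cases hw : w = 0
      · rw [hw]
      · obtain ⟨i, hi⟩ := exists_link_lt w hw
        rw [← ih _ hi]
        obtain ⟨k, hk⟩ := back w i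
        constructor
        · rintro ⟨h1, h2⟩
          exact ⟨h2 i, spread w i h1 h2⟩
        · rintro ⟨h1, h2⟩
          have h3 := spread _ k h1 h2
          rw [hk] at h3
          have h4 := h2 k
          rw [hk] at h4
          exact ⟨h4, h3⟩
  have h0 := (hall v).1 ⟨hv, fixes_link hπ hf hv ha hb⟩
  ext w
  rw [((hall w).2 h0).1]
  rfl

theorem automorphism_ext {π σ : Equiv.Perm (Fin 24)} (hπ : π ∈ automorphisms)
    (hσ : σ ∈ automorphisms) {v a b : Fin 24} (hf : Flag v a b) (hv : π v = σ v) (ha : π a = σ a)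
    (hb : π b = σ b) : π = σ := by
  have := eq_one_of_fixes_flag (automorphisms.mul_mem (automorphisms.inv_mem hσ) hπ) hf
    (by simp [hv]) (by simp [ha]) (by simp [hb])
  rwa [inv_mul_eq_one, eq_comm] at this

/-- A vertex, a neighbour and a direction around the vertex determine an automorphism. -/
theorem card_automorphisms_le : Nat.card automorphisms ≤ 384 := by
  classical
  have hf : ∀ π : automorphisms, ∃ x : Fin 24 × Fin 8 × Bool,
      π.1 0 = x.1 ∧ π.1 (link 0 0) = link x.1 x.2.1 ∧
        π.1 (link 0 1) = link x.1 (if x.2.2 then x.2.1 + 1 else x.2.1 - 1) := by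
    rintro ⟨π, hπ⟩
    have h := (hπ 0 _ _).2 (flag_link 0 0)
    obtain ⟨i, hi⟩ := h.exists_link
    have h' := h
    rw [← hi, flag_link_iff] at h'
    rcases h' with h' | h'
    · exact ⟨⟨π 0, i, true⟩, rfl, hi.symm, h'⟩
    · exact ⟨⟨π 0, i, false⟩, rfl, hi.symm, h'⟩
  choose f hf0 hf1 hf2 using hf
  have hinj : Function.Injective f := by
    intro π σ h
    apply Subtype.ext
    refine automorphism_ext π.2 σ.2 (flag_link 0 0) ?_ ?_ ?_
    · rw [hf0, hf0, h]
    · rw [hf1, hf1, h]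
    · rw [show (0 + 1 : Fin 8) = 1 from rfl, hf2, hf2, h]
  have := Nat.card_le_card_of_injective f hinj
  simpa using this

/-- If the elements of a list of automorphisms lie in different right cosets of `G`,
then the list bounds the order of `G`. -/
theorem card_mul_length_le {G : Subgroup (Equiv.Perm (Fin 24))} (hG : G ≤ automorphisms)
    {S : List (Equiv.Perm (Fin 24))} (hS : ∀ s ∈ S, s ∈ automorphisms)
    (h : S.Pairwise fun s t => t * s⁻¹ ∉ G) : Nat.card G * S.length ≤ 384 := by
  refine le_trans ?_ card_automorphisms_le
  have hcard : Nat.card G * S.length = Nat.card (G × Fin S.length) := by simp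
  rw [hcard]
  let f : G × Fin S.length → automorphisms := fun x =>
    ⟨x.1.1 * S[x.2], automorphisms.mul_mem (hG x.1.2) (hS _ (List.getElem_mem _))⟩
  have key : ∀ (g g' : G) (i j : Fin S.length), i < j → g.1 * S[i] ≠ g'.1 * S[j] := by
    intro g g' i j hij heq
    refine (List.pairwise_iff_getElem.1 h) i j i.2 j.2 hij ?_
    have : S[j] * S[i]⁻¹ = g'.1⁻¹ * g.1 := by
      rw [mul_inv_eq_iff_eq_mul, mul_assoc, heq]; simp
    have h2 := G.mul_mem (G.inv_mem g'.2) g.2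
    rw [← this] at h2
    exact h2
  refine Nat.card_le_card_of_injective f ?_
  rintro ⟨g, i⟩ ⟨g', j⟩ hx
  have heq : g.1 * S[i] = g'.1 * S[j] := congrArg Subtype.val hx
  rcases lt_trichotomy i j with hij | rfl | hij
  · exact absurd heq (key g g' i j hij)
  · have := mul_right_cancel heq
    rw [Subtype.ext this]
  · exact absurd heq.symm (key g' g j i hij)

end FrickeKlein

/-! ### Automorphisms of the map -/

namespace FrickeKlein

/-- The self-map of the vertices with the values given by the digits of a number in base 24. -/
def digitMap (c : ℕ) (v : Fin 24) : Fin 24 :=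
  -- The match makes the kernel evaluate the digit before it is used further, so products of
  -- permutations do not pile up unevaluated terms.
  match (c.div (Nat.pow 24 v)).mod 24 with
  | 0 => 0
  | k + 1 => Fin.ofNat 24 (k + 1)

/-- The permutation of the vertices with given digits. -/
def digitPerm (c d : ℕ) (h : ∀ v, digitMap d (digitMap c v) = v)
    (h' : ∀ v, digitMap c (digitMap d v) = v) : Equiv.Perm (Fin 24) :=
  ⟨digitMap c, digitMap d, h, h'⟩

/-- The rotation by one eighth of a turn around the vertex `0`. -/
def rot : Equiv.Perm (Fin 24) :=
  digitPerm 1303529007740942962480288430501616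
      1328797677099145262699191323959040 (by decide +kernel) (by decide +kernel)

/-- The rotation by a quarter-turn around the vertex `0`. -/
def quarterTurn₀ : Equiv.Perm (Fin 24) :=
  digitPerm 1316268490143013254901157145474888
      1326365194403307788438170619013288 (by decide +kernel) (by decide +kernel)

/-- A quarter-turn around another axis. -/
def quarterTurn₁ : Equiv.Perm (Fin 24) :=
  digitPerm 774159380574159010556262614757041
      552061442469471355509771349617906 (by decide +kernel) (by decide +kernel)

/-- A rotation of order 3 around a face. -/
def rot3 : Equiv.Perm (Fin 24) :=
  digitPerm 409353414764781723768637859202686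
      259024605757153200136647641351458 (by decide +kernel) (by decide +kernel)

/-- An orientation reversing automorphism of order 4 without fixed points. -/
def rotary : Equiv.Perm (Fin 24) :=
  digitPerm 982771743652886293144656672483421
      734462100367958088645417546159929 (by decide +kernel) (by decide +kernel)

/-- The half-turns around the vertices; each of them fixes 8 vertices. -/
def halfTurn : Fin 3 → Equiv.Perm (Fin 24)
  | 0 => digitPerm 1311804524219634158430350496991224
      1311804524219634158430350496991224 (by decide +kernel) (by decide +kernel)
  | 1 => digitPerm 885186229797389245483093417291043
      885186229797389245483093417291043 (by decide +kernel) (by decide +kernel)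
  | 2 => digitPerm 629553609006784150904662330784271
      629553609006784150904662330784271 (by decide +kernel) (by decide +kernel)

/-- Reflections that fix some vertices together with two of their neighbours. -/
def refl : Fin 3 → Equiv.Perm (Fin 24)
  | 0 => digitPerm 1312497798037112260662781463718936
      1312497798037112260662781463718936 (by decide +kernel) (by decide +kernel)
  | 1 => digitPerm 775428430536140495795385636673553
      775428430536140495795385636673553 (by decide +kernel) (by decide +kernel)
  | 2 => digitPerm 614784207752292997197004905219999
      614784207752292997197004905219999 (by decide +kernel) (by decide +kernel)

theorem rot_mem : rot ∈ automorphisms := by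
  apply mem_automorphisms_of_link <;> decide +kernel

theorem quarterTurn₀_mem : quarterTurn₀ ∈ automorphisms := by
  apply mem_automorphisms_of_link <;> decide +kernel

theorem quarterTurn₁_mem : quarterTurn₁ ∈ automorphisms := by
  apply mem_automorphisms_of_link <;> decide +kernel

theorem rot3_mem : rot3 ∈ automorphisms := by
  apply mem_automorphisms_of_link <;> decide +kernel

theorem rotary_mem : rotary ∈ automorphisms := by
  apply mem_automorphisms_of_link <;> decide +kernel

theorem halfTurn_mem (k : Fin 3) : halfTurn k ∈ automorphisms := by
  apply mem_automorphisms_of_link <;> revert k <;> decide +kernel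

theorem refl_mem (k : Fin 3) : refl k ∈ automorphisms := by
  apply mem_automorphisms_of_link <;> revert k <;> decide +kernel

/-- A central involution. -/
def central : Equiv.Perm (Fin 24) := halfTurn 0 * halfTurn 1 * halfTurn 2

theorem central_mem : central ∈ automorphisms :=
  automorphisms.mul_mem (automorphisms.mul_mem (halfTurn_mem 0) (halfTurn_mem 1)) (halfTurn_mem 2)

/-- The equality of two automorphisms, checked on the vertices of a face. -/
def agree (π σ : Equiv.Perm (Fin 24)) : Bool :=
  π 0 == σ 0 && π 1 == σ 1 && π 2 == σ 2

theorem eq_of_agree {π σ : Equiv.Perm (Fin 24)} (hπ : π ∈ automorphisms)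
    (hσ : σ ∈ automorphisms) (h : agree π σ) : π = σ := by
  simp only [agree, Bool.and_eq_true, beq_iff_eq] at h
  exact automorphism_ext hπ hσ (by decide +kernel : Flag 0 1 2) h.1.1 h.1.2 h.2

def isHalfTurn (π : Equiv.Perm (Fin 24)) : Bool :=
  agree π (halfTurn 0) || agree π (halfTurn 1) || agree π (halfTurn 2)

/-- The products of the half-turns around the vertices. -/
def translations : List (Equiv.Perm (Fin 24)) :=
  [1, halfTurn 0, halfTurn 1, halfTurn 2, halfTurn 0 * halfTurn 1, halfTurn 0 * halfTurn 2,
    halfTurn 1 * halfTurn 2, central]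

/-- The products of the half-turns and the quarter-turns around the vertices, modulo half-turns. -/
def quarterTurns : List (Equiv.Perm (Fin 24)) :=
  [1, quarterTurn₀, quarterTurn₁, quarterTurn₀ * quarterTurn₁]

/-- The involutions that act on the three axes of half-turns like the reflections. -/
def reflections : List (Equiv.Perm (Fin 24)) :=
  [refl 0, refl 1, refl 2].flatMap fun r => translations.map fun n => r * n

/-- Sixteen elements for the case that `central` belongs to the group. -/
def cosetsA : List (Equiv.Perm (Fin 24)) :=
  [1, halfTurn 0, halfTurn 1, halfTurn 2].flatMap fun n => quarterTurns.map fun q => n * q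

/-- Sixteen elements for the case that neither `central` nor an element of `reflections` belongs to
the group. -/
def cosetsB : List (Equiv.Perm (Fin 24)) :=
  [1, halfTurn 0].flatMap fun n => quarterTurns.flatMap fun q => [n * q, n * q * rotary]

/-- Sixteen elements for the case that an element of `reflections` belongs to the group. -/
def cosetsC : List (Equiv.Perm (Fin 24)) :=
  [1, halfTurn 0].flatMap fun n => quarterTurns.flatMap fun q => [n * q, n * q * rot3]

theorem mem_of_quarterTurns {q : Equiv.Perm (Fin 24)} (hq : q ∈ quarterTurns) :
    q ∈ automorphisms := by
  simp only [quarterTurns, List.mem_cons, List.not_mem_nil, or_false] at hq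
  rcases hq with rfl | rfl | rfl | rfl
  · exact automorphisms.one_mem
  · exact quarterTurn₀_mem
  · exact quarterTurn₁_mem
  · exact automorphisms.mul_mem quarterTurn₀_mem quarterTurn₁_mem

theorem mem_of_reflections {r : Equiv.Perm (Fin 24)} (hr : r ∈ reflections) :
    r ∈ automorphisms := by
  have hn : ∀ n ∈ translations, n ∈ automorphisms := by
    intro n hn
    have h := halfTurn_mem
    simp only [translations, List.mem_cons, List.not_mem_nil, or_false] at hn
    rcases hn with rfl | rfl | rfl | rfl | rfl | rfl | rfl | rfl
    · exact automorphisms.one_mem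
    · exact h 0
    · exact h 1
    · exact h 2
    · exact automorphisms.mul_mem (h 0) (h 1)
    · exact automorphisms.mul_mem (h 0) (h 2)
    · exact automorphisms.mul_mem (h 1) (h 2)
    · exact central_mem
  simp only [reflections, List.mem_flatMap, List.mem_map, List.mem_cons, List.not_mem_nil,
    or_false] at hr
  obtain ⟨s, hs, n, hn', rfl⟩ := hr
  refine automorphisms.mul_mem ?_ (hn n hn')
  rcases hs with rfl | rfl | rfl <;> exact refl_mem _

theorem mem_of_cosetsA {s : Equiv.Perm (Fin 24)} (hs : s ∈ cosetsA) : s ∈ automorphisms := by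
  simp only [cosetsA, List.mem_flatMap, List.mem_map, List.mem_cons, List.not_mem_nil,
    or_false] at hs
  obtain ⟨n, hn, q, hq, rfl⟩ := hs
  refine automorphisms.mul_mem ?_ (mem_of_quarterTurns hq)
  rcases hn with rfl | rfl | rfl | rfl
  · exact automorphisms.one_mem
  all_goals exact halfTurn_mem _

theorem mem_of_cosets {p : Equiv.Perm (Fin 24)} (hp : p ∈ automorphisms)
    {s : Equiv.Perm (Fin 24)}
    (hs : s ∈ [1, halfTurn 0].flatMap fun n => quarterTurns.flatMap fun q => [n * q, n * q * p]) :
    s ∈ automorphisms := by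
  simp only [List.mem_flatMap, List.mem_cons, List.not_mem_nil, or_false] at hs
  obtain ⟨n, hn, q, hq, hs⟩ := hs
  have h : n * q ∈ automorphisms := by
    refine automorphisms.mul_mem ?_ (mem_of_quarterTurns hq)
    rcases hn with rfl | rfl
    · exact automorphisms.one_mem
    · exact halfTurn_mem _
  rcases hs with rfl | rfl
  · exact h
  · exact automorphisms.mul_mem h hp

/-- Each alternative exhibits a half-turn in any group that contains `central` and the quotient `t *
s⁻¹`. -/
theorem cosetsA_pairwise : cosetsA.Pairwise fun s t =>
    (isHalfTurn (t * s⁻¹) || isHalfTurn (t * s⁻¹ * central) ||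
      isHalfTurn (t * s⁻¹ * (t * s⁻¹))) = true := by
  decide +kernel

theorem cosetsB_pairwise : cosetsB.Pairwise fun s t =>
    (isHalfTurn (t * s⁻¹) || isHalfTurn (t * s⁻¹ * (t * s⁻¹)) ||
      agree (t * s⁻¹) central || agree (t * s⁻¹ * (t * s⁻¹)) central ||
      reflections.any fun r => agree (t * s⁻¹) r) = true := by
  decide +kernel

/-- With `x = t * s⁻¹`, the last word is the square of `x * r * x⁻¹ * r`, so it lies in every group
that contains `x` and `r`. -/
theorem cosetsC_pairwise : (reflections.all fun r => decide (cosetsC.Pairwise fun s t =>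
    (isHalfTurn (t * s⁻¹) || isHalfTurn (t * s⁻¹ * (t * s⁻¹)) ||
      isHalfTurn (t * s⁻¹ * r * (s * t⁻¹) * r * (t * s⁻¹ * r * (s * t⁻¹) * r))) = true)) =
    true := by
  decide +kernel

/-- A group of automorphisms without half-turns around vertices has at most 24 elements. -/
theorem card_le_of_halfTurn_notMem {G : Subgroup (Equiv.Perm (Fin 24))} (hG : G ≤ automorphisms)
    (h : ∀ k, halfTurn k ∉ G) : Nat.card G ≤ 24 := by
  have not_mem : ∀ {π}, isHalfTurn π = true → π ∉ G := by
    intro π hπ hmem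
    simp only [isHalfTurn, Bool.or_eq_true] at hπ
    rcases hπ with (hπ | hπ) | hπ
    all_goals
      rw [eq_of_agree (hG hmem) (halfTurn_mem _) hπ] at hmem
      exact h _ hmem
  by_cases hc : central ∈ G
  · have key := card_mul_length_le hG (fun s => mem_of_cosetsA) (cosetsA_pairwise.imp (by
      intro s t hst hmem
      simp only [Bool.or_eq_true] at hst
      rcases hst with (hst | hst) | hst
      · exact not_mem hst hmem
      · exact not_mem hst (G.mul_mem hmem hc)
      · exact not_mem hst (G.mul_mem hmem hmem)))
    have hl : cosetsA.length = 16 := rfl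
    rw [hl] at key
    omega
  by_cases hr : ∃ r ∈ reflections, r ∈ G
  · obtain ⟨r, hr, hrG⟩ := hr
    have hC := List.all_eq_true.1 cosetsC_pairwise r hr
    rw [decide_eq_true_iff] at hC
    have key := card_mul_length_le hG (fun s => mem_of_cosets rot3_mem) (hC.imp (by
      intro s t hst hmem
      simp only [Bool.or_eq_true] at hst
      rcases hst with (hst | hst) | hst
      · exact not_mem hst hmem
      · exact not_mem hst (G.mul_mem hmem hmem)
      · have hinv : s * t⁻¹ ∈ G := by simpa using G.inv_mem hmem
        have hw := G.mul_mem (G.mul_mem (G.mul_mem hmem hrG) hinv) hrG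
        exact not_mem hst (G.mul_mem hw hw)))
    have hl : cosetsC.length = 16 := rfl
    rw [← cosetsC, hl] at key
    omega
  · have key := card_mul_length_le hG (fun s => mem_of_cosets rotary_mem)
      (cosetsB_pairwise.imp (by
        intro s t hst hmem
        simp only [Bool.or_eq_true, List.any_eq_true] at hst
        rcases hst with (((hst | hst) | hst) | hst) | ⟨r, hr', hst⟩
        · exact not_mem hst hmem
        · exact not_mem hst (G.mul_mem hmem hmem)
        · rw [eq_of_agree (hG hmem) central_mem hst] at hmem
          exact hc hmem
        · have h2 := G.mul_mem hmem hmem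
          rw [eq_of_agree (hG h2) central_mem hst] at h2
          exact hc h2
        · rw [eq_of_agree (hG hmem) (mem_of_reflections hr') hst] at hmem
          exact hr ⟨r, hr', hmem⟩))
    have hl : cosetsB.length = 16 := rfl
    rw [← cosetsB, hl] at key
    omega

end FrickeKlein

/-! ### Symmetric realizations of the map -/

namespace FrickeKlein

/-- The vertices of the map are placed at distinct points, such that every element of the group `G`
of automorphisms is induced by an isometry, and such that the edges opposite to a vertex in two
faces without further common vertices are disjoint. -/
structure Realizes (φ : Fin 24 → E3) (G : Subgroup (Equiv.Perm (Fin 24))) : Prop where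
  injective : Function.Injective φ
  le_automorphisms : G ≤ automorphisms
  exists_isometry : ∀ g ∈ G, ∃ h : Isom3, ∀ v, h (φ v) = φ (g v)
  disjoint : ∀ v a b c d, Flag v a b → Flag v c d → a ≠ c → a ≠ d → b ≠ c → b ≠ d →
    Disjoint (segment ℝ (φ a) (φ b)) (segment ℝ (φ c) (φ d))

/-- Relabelling by an automorphism conjugates the group. It serves to move any half-turn to
`halfTurn 0`, and an end point of its axis to the vertex `0`. -/
theorem Realizes.comp {φ : Fin 24 → E3} {G : Subgroup (Equiv.Perm (Fin 24))} (h : Realizes φ G)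
    {k : Equiv.Perm (Fin 24)} (hk : k ∈ automorphisms) :
    Realizes (φ ∘ k) (G.comap (MulAut.conj k).toMonoidHom) where
  injective := h.injective.comp k.injective
  le_automorphisms := by
    intro g hg
    have := h.le_automorphisms (Subgroup.mem_comap.1 hg)
    have h2 := automorphisms.mul_mem (automorphisms.mul_mem (automorphisms.inv_mem hk) this) hk
    simpa [mul_assoc] using h2
  exists_isometry := by
    intro g hg
    obtain ⟨f, hf⟩ := h.exists_isometry _ (Subgroup.mem_comap.1 hg)
    exact ⟨f, fun v => by simp [hf]⟩
  disjoint := by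
    intro v a b c d hab hcd hac had hbc hbd
    exact h.disjoint (k v) (k a) (k b) (k c) (k d) ((hk v a b).2 hab) ((hk v c d).2 hcd)
      (k.injective.ne hac) (k.injective.ne had) (k.injective.ne hbc) (k.injective.ne hbd)

theorem card_comap_conj (G : Subgroup (Equiv.Perm (Fin 24))) (k : Equiv.Perm (Fin 24)) :
    Nat.card (G.comap (MulAut.conj k).toMonoidHom) = Nat.card G :=
  Nat.card_congr (((MulAut.conj k).toEquiv.subtypeEquiv fun _ => Iff.rfl))

/-- The vertices on the axis of the half-turn around the vertex `0`. -/
def axis : Set (Fin 24) := {v | halfTurn 0 v = v}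

theorem halfTurn_link : ∀ i, halfTurn 0 (link 0 i) = link 0 (i + 4) := by decide +kernel

theorem zero_mem_axis : 0 ∈ axis := by
  change halfTurn 0 0 = 0
  decide +kernel

/-- The product of the four terms `f i * f (i + 1)` for `i = 0, 1, 2, 3` is minus a square, so they
cannot all be positive. -/
theorem exists_sign_change {f : Fin 8 → ℝ} (h0 : ∀ i, f i ≠ 0) (h : ∀ i, f (i + 4) = -f i) :
    ∃ i, f i * f (i + 1) < 0 := by
  by_contra! hc
  have h1 : ∀ i, 0 < f i * f (i + 1) := fun i =>
    lt_of_le_of_ne (hc i) (mul_ne_zero (h0 i) (h0 (i + 1))).symm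
  have a := h1 0
  have b := h1 1
  have c := h1 2
  have d := h1 3
  have e := h 0
  simp only [zero_add, Fin.reduceAdd] at a b c d e
  rw [e] at d
  have := mul_pos (mul_pos a b) (mul_pos c d)
  nlinarith [sq_nonneg (f 0 * f 1 * f 2 * f 3)]

/-- A half-turn around a vertex cannot be realized by a reflection, since opposite edges of the
link would intersect. -/
theorem Realizes.collinear_axis {φ : Fin 24 → E3} {G : Subgroup (Equiv.Perm (Fin 24))}
    (hφ : Realizes φ G) (hG : halfTurn 0 ∈ G) : Collinear ℝ (φ '' axis) := by
  obtain ⟨h, hh⟩ := hφ.exists_isometry _ hG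
  by_contra hcol
  set n : Fin 8 → E3 := fun i => φ (link 0 i) with hn
  have hn4 : ∀ i, h (n i) = n (i + 4) := fun i => by rw [hn, hh, halfTurn_link]
  have hne : ∀ i, n (i + 4) - n i ≠ 0 := by
    intro i he
    have := link_injective 0 (hφ.injective (sub_eq_zero.1 he))
    omega
  have hdim : 2 ≤ Module.finrank ℝ (vectorSpan ℝ (φ '' axis)) := by
    by_contra hlt
    exact hcol (collinear_iff_finrank_le_one.2 (by omega))
  have hdist : ∀ i, ∀ b ∈ φ '' axis, dist b (n i) = dist b (n (i + 4)) := by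
    rintro i _ ⟨b, hb, rfl⟩
    rw [← hn4, ← h.dist_map, hh, hb]
  -- The fixed points are equidistant from a neighbour and its image, so they lie in every bisecting
  -- plane. Having dimension at least 2, they span its direction, and hence all the chords `n (i +
  -- 4) - n i` are parallel.
  have hspan : ∀ i, vectorSpan ℝ (φ '' axis) = (Submodule.span ℝ {n (i + 4) - n i})ᗮ := by
    intro i
    have hle : vectorSpan ℝ (φ '' axis) ≤ (Submodule.span ℝ {n (i + 4) - n i})ᗮ := by
      have : affineSpan ℝ (φ '' axis) ≤ AffineSubspace.perpBisector (n i) (n (i + 4)) := by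
        rw [affineSpan_le]
        intro b hb
        exact AffineSubspace.mem_perpBisector_iff_dist_eq.2 (hdist i b hb)
      have h2 := AffineSubspace.direction_le this
      rwa [direction_affineSpan, AffineSubspace.direction_perpBisector] at h2
    apply Submodule.eq_of_le_of_finrank_le hle
    have hf : Fact (Module.finrank ℝ E3 = 2 + 1) := ⟨by simp⟩
    rw [Submodule.finrank_orthogonal_span_singleton (n := 2) (hne i)]
    exact hdim
  set u : E3 := n (0 + 4) - n 0 with hu
  have hu0 : u ≠ 0 := hne 0
  have huu : (0 : ℝ) < inner ℝ u u := real_inner_self_pos.2 hu0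
  have hpar : ∀ i, ∃ c : ℝ, c • u = n (i + 4) - n i := by
    intro i
    have h1 := (hspan i).symm.trans (hspan 0)
    have h2 := congrArg Submodule.orthogonal h1
    rw [Submodule.orthogonal_orthogonal, Submodule.orthogonal_orthogonal] at h2
    exact Submodule.mem_span_singleton.1 (h2 ▸ Submodule.mem_span_singleton_self _)
  choose c hc using hpar
  have hc0 : ∀ i, c i ≠ 0 := fun i hi => hne i (by rw [← hc, hi, zero_smul])
  set p := φ 0
  -- Up to a positive factor, `l` is the signed height over the mirror through `p`. Opposite
  -- neighbours have opposite heights.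
  set l : Fin 8 → ℝ := fun i => inner ℝ u (n i - p) with hl
  have hdiff : ∀ i, l (i + 4) - l i = c i * inner ℝ u u := by
    intro i
    simp only [hl]
    rw [← inner_sub_right, sub_sub_sub_cancel_right, ← hc, inner_smul_right]
  have hsum : ∀ i, l (i + 4) = -l i := by
    intro i
    have h1 := hdist i p ⟨0, zero_mem_axis, rfl⟩
    rw [dist_comm, dist_comm p, dist_eq_norm, dist_eq_norm] at h1
    have h2 : inner ℝ ((n (i + 4) - p) - (n i - p)) ((n (i + 4) - p) + (n i - p)) = (0 : ℝ) := by
      rw [inner_sub_left, inner_add_right, inner_add_right, real_inner_self_eq_norm_sq,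
        real_inner_self_eq_norm_sq, h1, real_inner_comm]
      ring
    rw [sub_sub_sub_cancel_right, ← hc, inner_smul_left, inner_add_right] at h2
    have h3 := (mul_eq_zero.1 h2).resolve_left (by simpa using hc0 i)
    simp only [hl]
    linarith
  have hl0 : ∀ i, l i ≠ 0 := by
    intro i hi
    have h1 := hdiff i
    rw [hsum, hi, neg_zero, sub_zero] at h1
    exact mul_ne_zero (hc0 i) huu.ne' h1.symm
  obtain ⟨i, hi⟩ := exists_sign_change hl0 hsum
  have hneq : l i - l (i + 1) ≠ 0 := by
    intro he
    rw [sub_eq_zero.1 he] at hi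
    nlinarith [mul_self_nonneg (l (i + 1))]
  -- The parameter at which the edge from `n i` to `n (i + 1)` crosses the mirror.
  set t : ℝ := l i / (l i - l (i + 1)) with ht
  have ht1 : 1 - t = - l (i + 1) / (l i - l (i + 1)) := by
    rw [ht]; field_simp; ring
  have ht0 : 0 ≤ t ∧ 0 ≤ 1 - t := by
    rw [ht1, ht]
    rcases mul_neg_iff.1 hi with ⟨h1, h2⟩ | ⟨h1, h2⟩
    · exact ⟨div_nonneg (by linarith) (by linarith), div_nonneg (by linarith) (by linarith)⟩
    · exact ⟨div_nonneg_of_nonpos (by linarith) (by linarith),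
        div_nonneg_of_nonpos (by linarith) (by linarith)⟩
  have hbal : (1 - t) * l i + t * l (i + 1) = 0 := by
    rw [ht1, ht]; field_simp; ring
  -- The crossing point is its own mirror image, so it also lies on the opposite edge of the link.
  have hq : (1 - t) • n i + t • n (i + 1) = (1 - t) • n (i + 4) + t • n (i + 1 + 4) := by
    have e1 : n (i + 4) = n i + c i • u := by rw [hc]; abel
    have e2 : n (i + 1 + 4) = n (i + 1) + c (i + 1) • u := by rw [hc]; abel
    have h1 : (1 - t) * c i + t * c (i + 1) = 0 := by
      have a := hdiff i
      have b := hdiff (i + 1)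
      rw [hsum] at a b
      have : ((1 - t) * c i + t * c (i + 1)) * inner ℝ u u = 0 := by
        linear_combination (-2) * hbal - (1 - t) * a - t * b
      exact (mul_eq_zero.1 this).resolve_right huu.ne'
    rw [e1, e2]
    have h2 : ((1 - t) * c i + t * c (i + 1)) • u = 0 := by rw [h1, zero_smul]
    rw [← sub_eq_zero]
    rw [← neg_eq_zero, ← h2]
    module
  have hdisj := hφ.disjoint 0 _ _ _ _ (flag_link 0 i)
    (show Flag 0 (link 0 (i + 4)) (link 0 (i + 1 + 4)) by
      have := flag_link 0 (i + 4)
      rwa [show i + 4 + 1 = i + 1 + 4 by omega] at this)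
    (fun e => by have := link_injective 0 e; omega) (fun e => by have := link_injective 0 e; omega)
    (fun e => by have := link_injective 0 e; omega) (fun e => by have := link_injective 0 e; omega)
  exact Set.disjoint_left.1 hdisj ⟨1 - t, t, ht0.2, ht0.1, by ring, rfl⟩
    ⟨1 - t, t, ht0.2, ht0.1, by ring, hq.symm⟩

end FrickeKlein

/-! ### Metric constraints on the axis of a half-turn -/

namespace FrickeKlein

/-- If the distance of two points of a collinear set is maximal, then a third point has smaller
distances from all other points. -/
theorem dist_lt_of_collinear {s : Set E3} (hs : Collinear ℝ s) {x y z w : E3} (hx : x ∈ s)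
    (hy : y ∈ s) (hz : z ∈ s) (hw : w ∈ s) (hmax : ∀ a ∈ s, ∀ b ∈ s, dist a b ≤ dist x y)
    (hzx : z ≠ x) (hzy : z ≠ y) : dist z w < dist x y := by
  obtain ⟨p, v, hv⟩ := (collinear_iff_exists_forall_eq_smul_vadd (k := ℝ) s).1 hs
  obtain ⟨tx, rfl⟩ := hv x hx
  obtain ⟨ty, rfl⟩ := hv y hy
  obtain ⟨tz, rfl⟩ := hv z hz
  obtain ⟨tw, rfl⟩ := hv w hw
  have hv0 : 0 < ‖v‖ := by
    rw [norm_pos_iff]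
    rintro rfl
    simp at hzx
  have hd : ∀ a b : ℝ, dist (a • v +ᵥ p) (b • v +ᵥ p) = |a - b| * ‖v‖ := by
    intro a b
    rw [dist_vadd_cancel_right, dist_eq_norm, ← sub_smul, norm_smul, Real.norm_eq_abs]
  have hne : ∀ a b : ℝ, a • v +ᵥ p ≠ b • v +ᵥ p → a ≠ b := by
    rintro a b h rfl
    exact h rfl
  have m1 := hmax _ hz _ hx
  have m2 := hmax _ hz _ hy
  have m3 := hmax _ hw _ hx
  have m4 := hmax _ hw _ hy
  have n1 := hne _ _ hzx
  have n2 := hne _ _ hzy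
  rw [hd, hd] at m1 m2 m3 m4 ⊢
  rw [mul_le_mul_iff_left₀ hv0] at m1 m2 m3 m4
  rw [mul_lt_mul_iff_left₀ hv0]
  rw [abs_le] at m1 m2 m3 m4
  rcases le_total tx ty with h | h
  · rw [abs_of_nonpos (sub_nonpos.2 h)] at m1 m2 m3 m4 ⊢
    have l1 : tx < tz := lt_of_le_of_ne (by linarith) n1.symm
    have l2 : tz < ty := lt_of_le_of_ne (by linarith) n2
    rw [abs_lt]
    constructor <;> linarith
  · rw [abs_of_nonneg (sub_nonneg.2 h)] at m1 m2 m3 m4 ⊢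
    have l1 : tz < tx := lt_of_le_of_ne (by linarith) n1
    have l2 : ty < tz := lt_of_le_of_ne (by linarith) n2.symm
    rw [abs_lt]
    constructor <;> linarith

/-- An isometry that fixes two points of a line fixes the line. -/
theorem isometry_eq_of_collinear {s : Set E3} (hs : Collinear ℝ s) {x y z : E3} (hx : x ∈ s)
    (hy : y ∈ s) (hz : z ∈ s) (hxy : x ≠ y) {h : Isom3} (h1 : h x = x) (h2 : h y = y) :
    h z = z := by
  obtain ⟨v, hv⟩ := (collinear_iff_of_mem hx).1 hs
  obtain ⟨ty, hty⟩ := hv y hy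
  obtain ⟨tz, htz⟩ := hv z hz
  have hty0 : ty ≠ 0 := by
    rintro rfl
    apply hxy
    simpa using hty.symm
  have hz' : z = AffineMap.lineMap x y (tz / ty) := by
    rw [AffineMap.lineMap_apply, hty, htz, vadd_vsub, smul_smul, div_mul_cancel₀ _ hty0]
  have := h.toAffineEquiv.toAffineMap.apply_lineMap x y (tz / ty)
  rw [← hz'] at this
  change h z = AffineMap.lineMap (h x) (h y) (tz / ty) at this
  rw [this, h1, h2, ← hz']

def axisList : List (Fin 24) := (List.finRange 24).filter fun v => halfTurn 0 v == v

theorem mem_axisList {v : Fin 24} : v ∈ axisList ↔ v ∈ axis := by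
  simp [axisList, axis]

/-- Two points of the axis are fixed and another one is not. -/
def fixesTwo (x : Equiv.Perm (Fin 24)) : Bool :=
  axisList.any fun a => axisList.any fun b => axisList.any fun c =>
    a != b && x a == a && x b == b && x c != c

/-- Representatives of the automorphisms fixing the vertex `0`, modulo the half-turn. -/
def cosetsFixing : List (Equiv.Perm (Fin 24)) :=
  [1, rot, rot * rot, rot * rot * rot].flatMap fun r => [r, r * refl 0]

/-- Eight elements fixing `0`, and their composites with `halfTurn k`, which for `k ≠ 0` move `0` to
another point of the axis. -/
def cosetsD (k : Fin 3) : List (Equiv.Perm (Fin 24)) :=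
  cosetsFixing ++ cosetsFixing.map fun d => halfTurn k * d

/-- The first alternative contradicts that an isometry fixing two points of a line fixes the line.
The second preserves the axis but moves `0` to `halfTurn k 0`, which is impossible if `0` is an end
point and its image is an inner point. -/
theorem cosetsD_pairwise : ∀ k : Fin 3, k ≠ 0 → (cosetsD k).Pairwise fun s t =>
    (fixesTwo (t * s⁻¹) || (t * s⁻¹) 0 == halfTurn k 0 &&
      axisList.all fun a => halfTurn 0 ((t * s⁻¹) a) == (t * s⁻¹) a) = true := by
  decide +kernel

theorem mem_of_cosetsD {k : Fin 3} {s : Equiv.Perm (Fin 24)} (hs : s ∈ cosetsD k) :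
    s ∈ automorphisms := by
  have hd : ∀ d ∈ cosetsFixing, d ∈ automorphisms := by
    intro d hd
    simp only [cosetsFixing, List.mem_flatMap, List.mem_cons, List.not_mem_nil, or_false] at hd
    obtain ⟨r, hr, hd⟩ := hd
    have h2 := automorphisms.mul_mem rot_mem rot_mem
    have hr' : r ∈ automorphisms := by
      rcases hr with rfl | rfl | rfl | rfl
      · exact automorphisms.one_mem
      · exact rot_mem
      · exact h2
      · exact automorphisms.mul_mem h2 rot_mem
    rcases hd with rfl | rfl
    · exact hr'
    · exact automorphisms.mul_mem hr' (refl_mem 0)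
  simp only [cosetsD, List.mem_append, List.mem_map] at hs
  rcases hs with hs | ⟨d, hs, rfl⟩
  · exact hd s hs
  · exact automorphisms.mul_mem (halfTurn_mem k) (hd d hs)

theorem halfTurn_zero : halfTurn 1 0 ≠ halfTurn 2 0 ∧
    ∀ k : Fin 3, k ≠ 0 → halfTurn k 0 ≠ 0 ∧ halfTurn 0 (halfTurn k 0) = halfTurn k 0 := by
  decide +kernel

/-- The bound for a realization with a half-turn such that the vertex `0` is an extremal point of
its axis. -/
theorem Realizes.card_le_of_extremal {φ : Fin 24 → E3} {G : Subgroup (Equiv.Perm (Fin 24))}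
    (hφ : Realizes φ G) (hG : halfTurn 0 ∈ G) {w : Fin 24} (hw : w ∈ axis)
    (hmax : ∀ a ∈ axis, ∀ b ∈ axis, dist (φ a) (φ b) ≤ dist (φ 0) (φ w)) : Nat.card G ≤ 24 := by
  have hcol := hφ.collinear_axis hG
  -- The image of `0` must not be the other end `w`. As `halfTurn 1` and `halfTurn 2` send `0` to
  -- different points, one of them will do.
  obtain ⟨k, hk0, hkw⟩ : ∃ k : Fin 3, k ≠ 0 ∧ halfTurn k 0 ≠ w := by
    by_cases h1 : halfTurn 1 0 = w
    · exact ⟨2, by decide, fun h2 => halfTurn_zero.1 (h1.trans h2.symm)⟩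
    · exact ⟨1, by decide, h1⟩
  have key := card_mul_length_le hφ.le_automorphisms (fun s => mem_of_cosetsD)
    ((cosetsD_pairwise k hk0).imp (by
      intro s t hst hmem
      obtain ⟨h, hh⟩ := hφ.exists_isometry _ hmem
      simp only [Bool.or_eq_true, Bool.and_eq_true, List.all_eq_true, beq_iff_eq, fixesTwo,
        List.any_eq_true, bne_iff_ne] at hst
      rcases hst with ⟨a, ha, b, hb, c, hc, ⟨⟨hab, hxa⟩, hxb⟩, hxc⟩ | ⟨hx0, hx⟩
      · rw [mem_axisList] at ha hb hc
        have := isometry_eq_of_collinear hcol ⟨a, ha, rfl⟩ ⟨b, hb, rfl⟩ ⟨c, hc, rfl⟩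
          (hφ.injective.ne hab) (h := h) (by rw [hh, hxa]) (by rw [hh, hxb])
        rw [hh] at this
        exact hxc (hφ.injective this)
      · have hu : halfTurn k 0 ∈ axis := (halfTurn_zero.2 k hk0).2
        have hw' : (t * s⁻¹) w ∈ axis := hx w (mem_axisList.2 hw)
        -- The isometry would carry a pair at maximal distance to a pair at smaller distance.
        have := dist_lt_of_collinear hcol ⟨0, zero_mem_axis, rfl⟩ ⟨w, hw, rfl⟩
          ⟨halfTurn k 0, hu, rfl⟩ ⟨_, hw', rfl⟩
          (by rintro _ ⟨a, ha, rfl⟩ _ ⟨b, hb, rfl⟩; exact hmax a ha b hb)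
          (hφ.injective.ne (halfTurn_zero.2 k hk0).1) (hφ.injective.ne hkw)
        rw [← hx0, ← hh, ← hh, h.dist_map] at this
        exact lt_irrefl _ this))
  have hl : (cosetsD k).length = 16 := rfl
  rw [hl] at key
  omega

/-- Automorphisms that commute with the half-turn around `0` and act transitively on its axis. -/
def axisMoves : List (Equiv.Perm (Fin 24)) :=
  [1, halfTurn 1, halfTurn 2, halfTurn 1 * halfTurn 2].flatMap fun n => [n, n * rotary]

theorem mem_of_axisMoves {s : Equiv.Perm (Fin 24)} (hs : s ∈ axisMoves) : s ∈ automorphisms := by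
  simp only [axisMoves, List.mem_flatMap, List.mem_cons, List.not_mem_nil, or_false] at hs
  obtain ⟨n, hn, hs⟩ := hs
  have h : n ∈ automorphisms := by
    rcases hn with rfl | rfl | rfl | rfl
    · exact automorphisms.one_mem
    · exact halfTurn_mem _
    · exact halfTurn_mem _
    · exact automorphisms.mul_mem (halfTurn_mem _) (halfTurn_mem _)
  rcases hs with rfl | rfl
  · exact h
  · exact automorphisms.mul_mem h rotary_mem

theorem axisMoves_transitive : ∀ v, halfTurn 0 v = v → axisMoves.any (fun k => k 0 == v) := by
  decide +kernel

theorem axisMoves_comm : (axisMoves.all fun k => (List.finRange 24).all fun v =>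
    halfTurn 0 (k v) == k (halfTurn 0 v)) = true := by
  decide +kernel

/-- An end point of the axis can be moved to `0` by an automorphism commuting with `halfTurn 0`.
This preserves both the axis and the membership of the half-turn in the group. -/
theorem Realizes.card_le_of_halfTurn {φ : Fin 24 → E3} {G : Subgroup (Equiv.Perm (Fin 24))}
    (hφ : Realizes φ G) (hG : halfTurn 0 ∈ G) : Nat.card G ≤ 24 := by
  obtain ⟨⟨w, w'⟩, hw, hmax⟩ := Set.exists_max_image (axis ×ˢ axis)
    (fun x => dist (φ x.1) (φ x.2)) (Set.toFinite _) ⟨(0, 0), zero_mem_axis, zero_mem_axis⟩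
  have hk := axisMoves_transitive w hw.1
  simp only [List.any_eq_true, beq_iff_eq] at hk
  obtain ⟨k, hk, hk0⟩ := hk
  have hcomm := List.all_eq_true.1 axisMoves_comm k hk
  simp only [List.all_eq_true, List.mem_finRange, forall_true_left, beq_iff_eq] at hcomm
  have hka : ∀ v, v ∈ axis ↔ k v ∈ axis := by
    intro v
    change halfTurn 0 v = v ↔ halfTurn 0 (k v) = k v
    rw [hcomm, k.injective.eq_iff]
  rw [← card_comap_conj G k]
  refine (hφ.comp (mem_of_axisMoves hk)).card_le_of_extremal (w := k.symm w') ?_ ?_ ?_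
  · rw [Subgroup.mem_comap]
    convert hG
    ext1 v
    simp [← hcomm]
  · rw [hka]
    simpa using hw.2
  · intro a ha b hb
    simpa [hk0] using hmax (k a, k b) ⟨(hka a).1 ha, (hka b).1 hb⟩

theorem halfTurn_conj :
    halfTurn 1 = rot3 * halfTurn 0 * rot3⁻¹ ∧ halfTurn 2 = rot3⁻¹ * halfTurn 0 * rot3 := by
  constructor <;> ext1 v <;> revert v <;> decide +kernel

/-- At most 24 automorphisms are induced by isometries. -/
theorem Realizes.card_le {φ : Fin 24 → E3} {G : Subgroup (Equiv.Perm (Fin 24))}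
    (hφ : Realizes φ G) : Nat.card G ≤ 24 := by
  by_contra hlt
  apply hlt
  -- A half-turn in `G` would already give the bound. The conjugations by `rot3` reduce it to
  -- `halfTurn 0`.
  refine card_le_of_halfTurn_notMem hφ.le_automorphisms fun k hk => hlt ?_
  have red : ∀ r ∈ automorphisms, r * halfTurn 0 * r⁻¹ ∈ G → Nat.card G ≤ 24 := by
    intro r hr hrG
    rw [← card_comap_conj G r]
    exact (hφ.comp hr).card_le_of_halfTurn (Subgroup.mem_comap.2 hrG)
  fin_cases k
  · exact hφ.card_le_of_halfTurn hk
  · exact red rot3 rot3_mem (halfTurn_conj.1 ▸ hk)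
  · refine red rot3⁻¹ (automorphisms.inv_mem rot3_mem) ?_
    rw [inv_inv, ← halfTurn_conj.2]
    exact hk

end FrickeKlein

/-! ### The faces of the Fricke-Klein map -/

namespace FrickeKlein

/-- The coordinates of the vertices, shifted by 8, as digits in base 16. -/
def labelCode : ℕ :=
  74968546036897132635085790732573831021744318030760088228568835595362352279898140585641

/-- The integer point with the given number. -/
def label (v : Fin 24) (i : Fin 3) : ℤ :=
  (((labelCode.div (Nat.pow 16 (3 * v + i))).mod 16 : ℕ) : ℤ) - 8

theorem label_injective : Function.Injective label := by
  have h : ∀ v w, (∀ i, label v i = label w i) → v = w := by decide +kernel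
  exact fun v w hvw => h v w (congrFun hvw)

/-- A signed permutation of the coordinates. -/
def signedPerm (p : Equiv.Perm (Fin 3)) (s : Fin 3 → ℤˣ) (x : Fin 3 → ℤ) (i : Fin 3) : ℤ :=
  (s i : ℤ) * x (p i)

/-- The base triangles with ordered vertices, so that the finite checks compare integers instead of
finite sets of functions. -/
def baseFace : Fin 4 → Fin 3 → Fin 3 → ℤ
  | 0 => ![![1, 2, 6], ![2, 6, 1], ![6, 1, 2]]
  | 1 => ![![1, 2, 6], ![2, 6, 1], ![-2, 1, 6]]
  | 2 => ![![2, -1, 6], ![-1, 6, 2], ![6, 2, -1]]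
  | 3 => ![![2, -1, 6], ![-1, 6, 2], ![-2, 6, -1]]

theorem mem_frickeKleinBase {t : Finset (Fin 3 → ℤ)} :
    t ∈ frickeKleinBase ↔ ∃ k, t = {baseFace k 0, baseFace k 1, baseFace k 2} := by
  rw [frickeKleinBase]
  simp only [Finset.mem_insert, Finset.mem_singleton]
  constructor
  · rintro (rfl | rfl | rfl | rfl)
    · exact ⟨0, rfl⟩
    · exact ⟨1, rfl⟩
    · exact ⟨2, rfl⟩
    · exact ⟨3, rfl⟩
  · rintro ⟨k, rfl⟩
    fin_cases k
    · exact Or.inl rfl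
    · exact Or.inr (Or.inl rfl)
    · exact Or.inr (Or.inr (Or.inl rfl))
    · exact Or.inr (Or.inr (Or.inr rfl))

theorem exists_flag_of_baseFace : ∀ (p : Equiv.Perm (Fin 3)) (s : Fin 3 → ℤˣ),
    Equiv.Perm.sign p * ∏ i, s i = 1 → ∀ k : Fin 4, ∃ v : Fin 24,
      (∀ i, label v i = signedPerm p s (baseFace k 0) i) ∧ ∃ j : Fin 8,
        ((∀ i, label (link v j) i = signedPerm p s (baseFace k 1) i) ∧
          ∀ i, label (link v (j + 1)) i = signedPerm p s (baseFace k 2) i) ∨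
        ((∀ i, label (link v (j + 1)) i = signedPerm p s (baseFace k 1) i) ∧
          ∀ i, label (link v j) i = signedPerm p s (baseFace k 2) i) := by
  decide +kernel

/-- Requiring `v` to be the smallest vertex treats each face once. The permutation `q` allows for
any order of the base triangle. -/
theorem exists_baseFace_of_link : ∀ v j, v < link v j → v < link v (j + 1) →
    ∃ (p : Equiv.Perm (Fin 3)) (s : Fin 3 → ℤˣ), Equiv.Perm.sign p * ∏ i, s i = 1 ∧
    ∃ (k : Fin 4) (q : Equiv.Perm (Fin 3)),
      (∀ i, label v i = signedPerm p s (baseFace k (q 0)) i) ∧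
      (∀ i, label (link v j) i = signedPerm p s (baseFace k (q 1)) i) ∧
      ∀ i, label (link v (j + 1)) i = signedPerm p s (baseFace k (q 2)) i := by
  decide +kernel

/-- The three vertices of a face can be numbered in increasing order. -/
theorem Flag.exists_lt {v a b : Fin 24} (h : Flag v a b) : ∃ v' a' b', Flag v' a' b' ∧ v' < a' ∧
    v' < b' ∧ ({v, a, b} : Finset (Fin 24)) = {v', a', b'} := by
  obtain ⟨h1, h2, h3⟩ := h.ne
  rcases lt_or_gt_of_ne h1 with h1 | h1 <;> rcases lt_or_gt_of_ne h2 with h2 | h2 <;>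
    rcases lt_or_gt_of_ne h3 with h3 | h3
  all_goals first
    | exact ⟨v, a, b, h, by omega, by omega, rfl⟩
    | exact ⟨a, b, v, h.rotate, by omega, by omega, by ext; simp; tauto⟩
    | exact ⟨b, v, a, h.rotate.rotate, by omega, by omega, by ext; simp; tauto⟩

theorem image_signedPerm (p : Equiv.Perm (Fin 3)) (s : Fin 3 → ℤˣ) (x y z : Fin 3 → ℤ) :
    ({x, y, z} : Finset (Fin 3 → ℤ)).image (fun v i => (s i : ℤ) * v (p i)) =
      {signedPerm p s x, signedPerm p s y, signedPerm p s z} := by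
  rw [Finset.image_insert, Finset.image_insert, Finset.image_singleton]
  rfl

/-- The bridge between the orbit definition of the map and the numbered table. Each inclusion rests
on one of the two finite checks above. -/
theorem mem_frickeKleinMap {f : Finset (Fin 3 → ℤ)} :
    f ∈ frickeKleinMap ↔ ∃ v a b, Flag v a b ∧ f = {label v, label a, label b} := by
  constructor
  · rintro ⟨p, s, hs, t, ht, rfl⟩
    obtain ⟨k, rfl⟩ := mem_frickeKleinBase.1 ht
    rw [image_signedPerm]
    obtain ⟨v, h0, j, ⟨h1, h2⟩ | ⟨h1, h2⟩⟩ := exists_flag_of_baseFace p s hs k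
    · exact ⟨v, _, _, flag_link v j, by rw [funext h0, funext h1, funext h2]⟩
    · exact ⟨v, _, _, (flag_link v j).swap, by rw [funext h0, funext h1, funext h2]⟩
  · rintro ⟨v, a, b, h, rfl⟩
    obtain ⟨v', a', b', ⟨j, hj⟩, ha, hb, heq⟩ := h.exists_lt
    have key : ∀ v j, v < link v j → v < link v (j + 1) →
        ({label v, label (link v j), label (link v (j + 1))} : Finset _) ∈ frickeKleinMap := by
      intro v j h1 h2
      obtain ⟨p, s, hs, k, q, e0, e1, e2⟩ := exists_baseFace_of_link v j h1 h2
      refine ⟨p, s, hs, _, mem_frickeKleinBase.2 ⟨k, rfl⟩, ?_⟩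
      rw [image_signedPerm, funext e0, funext e1, funext e2]
      have := congrArg (Finset.image fun i => signedPerm p s (baseFace k i))
        (Finset.image_univ_equiv q)
      rw [Finset.image_image] at this
      simpa [Finset.image_insert, Fin.univ_succ] using this
    have h2 := congrArg (Finset.image label) heq
    simp only [Finset.image_insert, Finset.image_singleton] at h2
    rw [h2]
    rcases hj with ⟨rfl, rfl⟩ | ⟨rfl, rfl⟩
    · exact key v' j ha hb
    · rw [Finset.pair_comm]
      exact key v' j hb ha

end FrickeKlein

/-! ### Faces and symmetries of polyhedra -/

/-- Krein–Milman. The closure can be dropped because there are finitely many extreme points. -/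
theorem IsConvexPolygon.convexHull_polygonVertices {F : Set E3} (hF : IsConvexPolygon F) :
    convexHull ℝ (polygonVertices F) = F := by
  obtain ⟨⟨s, hs, rfl⟩, -⟩ := hF
  have h := closure_convexHull_extremePoints (hs.isCompact_convexHull ℝ) (convex_convexHull ℝ s)
  rwa [((hs.subset extremePoints_convexHull_subset).isClosed_convexHull ℝ).closure_eq] at h

theorem mem_polygonVertices_image {g : Isom3} {F : Set E3} {x : E3} :
    g x ∈ polygonVertices (g '' F) ↔ x ∈ polygonVertices F := by
  have hseg : ∀ x y : E3, g '' openSegment ℝ x y = openSegment ℝ (g x) (g y) :=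
    image_openSegment ℝ g.toAffineEquiv.toAffineMap
  rw [polygonVertices, polygonVertices, mem_extremePoints_iff_left, mem_extremePoints_iff_left,
    g.injective.mem_set_image, Set.forall_mem_image]
  refine and_congr_right fun _ => forall₂_congr fun y _ => ?_
  rw [Set.forall_mem_image]
  refine forall₂_congr fun z _ => ?_
  rw [← hseg, g.injective.mem_set_image, g.injective.eq_iff]

theorem image_polygonVertices (g : Isom3) (F : Set E3) :
    polygonVertices (g '' F) = g '' polygonVertices F := by
  ext b
  obtain ⟨a, rfl⟩ := g.surjective b
  rw [mem_polygonVertices_image, g.injective.mem_set_image]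

theorem left_mem_extremePoints_segment (x y : E3) : x ∈ (segment ℝ x y).extremePoints ℝ := by
  rcases eq_or_ne x y with rfl | hne
  · simp
  refine mem_extremePoints_iff_left.2 ⟨left_mem_segment ℝ x y, ?_⟩
  -- The component of the combination along `y - x` is a sum of nonnegative terms that has to
  -- vanish, which forces `b = 0`.
  rintro _ ⟨a, b, ha, hb, hab, rfl⟩ _ ⟨c, d, hc, hd, hcd, rfl⟩ ⟨s, t, hs, ht, hst, h⟩
  have h1 : (s * b + t * d) • (y - x) = 0 := by
    have e : (s * b + t * d) • (y - x) =
        s • (a • x + b • y) + t • (c • x + d • y) - (s * (a + b) + t * (c + d)) • x := by module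
    rw [e, h, hab, hcd, mul_one, mul_one, hst, one_smul, sub_self]
  have h2 := (smul_eq_zero.1 h1).resolve_right (sub_ne_zero.2 hne.symm)
  have hb0 : b = 0 := by nlinarith [mul_nonneg hs.le hb, mul_nonneg ht.le hd]
  subst hb0
  rw [add_zero] at hab
  simp [hab]

namespace Polyhedron

/-- Two faces intersect in the convex hull of their common vertices. -/
theorem mem_convexHull_inter {P : Polyhedron} {F G : Set E3} (hF : F ∈ P.faces)
    (hG : G ∈ P.faces) (hne : F ≠ G) {x : E3} (hx : x ∈ F ∩ G) :
    x ∈ convexHull ℝ (polygonVertices F ∩ polygonVertices G) := by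
  rcases P.inter F hF G hG hne with h | ⟨v, hvF, hvG, h⟩ | ⟨⟨⟨u, v, -, h⟩, h1⟩, ⟨-, h2⟩⟩
  · rw [h] at hx
    exact hx.elim
  · rw [h] at hx
    rw [hx]
    exact subset_convexHull ℝ _ ⟨hvF, hvG⟩
  · have hu : u ∈ (F ∩ G).extremePoints ℝ := h ▸ left_mem_extremePoints_segment u v
    have hv : v ∈ (F ∩ G).extremePoints ℝ := by
      rw [h, segment_symm]
      exact left_mem_extremePoints_segment v u
    rw [h] at hx
    refine (convex_convexHull ℝ _).segment_subset (subset_convexHull ℝ _ ?_)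
      (subset_convexHull ℝ _ ?_) hx
    · exact ⟨h1.extremePoints_subset_extremePoints hu, h2.extremePoints_subset_extremePoints hu⟩
    · exact ⟨h1.extremePoints_subset_extremePoints hv, h2.extremePoints_subset_extremePoints hv⟩

/-- Two faces with two common vertices are adjacent. -/
theorem not_coplanar_of_mem {P : Polyhedron} {F G : Set E3} (hF : F ∈ P.faces)
    (hG : G ∈ P.faces) (hne : F ≠ G) {x y : E3} (hxy : x ≠ y) (hx : x ∈ F ∩ G)
    (hy : y ∈ F ∩ G) : ¬ Coplanar ℝ (F ∪ G) := by
  refine P.not_coplanar F hF G hG hne ?_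
  rcases P.inter F hF G hG hne with h | ⟨v, -, -, h⟩ | h
  · rw [h] at hx
    exact hx.elim
  · rw [h] at hx hy
    exact absurd (hx.trans hy.symm) hxy
  · exact ⟨_, h⟩

end Polyhedron

/-- An isometry that fixes the points of a set that is not coplanar is the identity. -/
theorem isometry_eq_one_of_not_coplanar {s : Set E3} {g : Isom3} (hs : ¬ Coplanar ℝ s)
    (h : ∀ x ∈ s, g x = x) : g = 1 := by
  by_contra hg
  obtain ⟨y, hy⟩ : ∃ y, g y ≠ y := by
    by_contra! hc
    exact hg (AffineIsometryEquiv.ext hc)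
  apply hs
  -- Fixed points are equidistant from `y` and `g y`, so they would all lie in one plane.
  have hle : affineSpan ℝ s ≤ AffineSubspace.perpBisector (g y) y := by
    rw [affineSpan_le]
    intro x hx
    rw [SetLike.mem_coe, AffineSubspace.mem_perpBisector_iff_dist_eq]
    conv_lhs => rw [← h x hx]
    exact g.dist_map x y
  have h2 := AffineSubspace.direction_le hle
  rw [direction_affineSpan, AffineSubspace.direction_perpBisector] at h2
  have hf : Fact (Module.finrank ℝ E3 = 2 + 1) := ⟨by simp⟩
  have h3 := Submodule.finrank_mono h2
  rw [Submodule.finrank_orthogonal_span_singleton (n := 2)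
    (by rw [vsub_eq_sub]; exact sub_ne_zero.2 hy.symm)] at h3
  exact coplanar_iff_finrank_le_two.2 h3

/-! ### From polyhedral embeddings to symmetric realizations -/

namespace FrickeKlein

/-- Symmetries carry vertex sets to vertex sets without an order, so `Flag` has to be recovered from
a set. -/
theorem flag_of_insert_eq {v a b v' a' b' : Fin 24} (h : Flag v a b)
    (he : ({v', a', b'} : Set (Fin 24)) = {v, a, b}) (h1 : v' ≠ a') (h2 : v' ≠ b')
    (h3 : a' ≠ b') : Flag v' a' b' := by
  have e1 : v' ∈ ({v, a, b} : Set (Fin 24)) := he ▸ by simp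
  have e2 : a' ∈ ({v, a, b} : Set (Fin 24)) := he ▸ by simp
  have e3 : b' ∈ ({v, a, b} : Set (Fin 24)) := he ▸ by simp
  simp only [Set.mem_insert_iff, Set.mem_singleton_iff] at e1 e2 e3
  rcases e1 with rfl | rfl | rfl <;> rcases e2 with rfl | rfl | rfl <;>
    rcases e3 with rfl | rfl | rfl
  all_goals first
    | exact absurd rfl h1
    | exact absurd rfl h2
    | exact absurd rfl h3
    | exact h
    | exact h.swap
    | exact h.rotate
    | exact h.rotate.swap
    | exact h.rotate.rotate
    | exact h.rotate.rotate.swap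

/-- The faces of `P` are the triangles with vertices `φ v`, `φ a`, `φ b` for the faces of the map. -/
structure IsPlacement (P : Polyhedron) (φ : Fin 24 → E3) : Prop where
  injective : Function.Injective φ
  mem_faces : ∀ S : Set E3,
    S ∈ polygonVertices '' P.faces ↔ ∃ v a b, Flag v a b ∧ S = {φ v, φ a, φ b}

theorem exists_placement {P : Polyhedron} (hP : P.IsEmbeddingOf frickeKleinMap) :
    ∃ φ, IsPlacement P φ := by
  obtain ⟨ψ, hψ, hfaces⟩ := hP
  refine ⟨ψ ∘ label, ?_, ?_⟩
  · intro v w h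
    have hmem : ∀ v, label v ∈ {v | ∃ f ∈ frickeKleinMap, v ∈ f} := fun v =>
      ⟨_, mem_frickeKleinMap.2 ⟨v, _, _, flag_link v 0, rfl⟩, by simp⟩
    exact label_injective (hψ (hmem v) (hmem w) h)
  · intro S
    rw [hfaces]
    constructor
    · rintro ⟨f, hf, rfl⟩
      obtain ⟨v, a, b, h, rfl⟩ := mem_frickeKleinMap.1 hf
      exact ⟨v, a, b, h, by simp [Set.image_insert_eq]⟩
    · rintro ⟨v, a, b, h, rfl⟩
      exact ⟨_, mem_frickeKleinMap.2 ⟨v, a, b, h, rfl⟩, by simp [Set.image_insert_eq]⟩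

namespace IsPlacement

variable {P : Polyhedron} {φ : Fin 24 → E3}

theorem exists_face (h : IsPlacement P φ) {v a b : Fin 24} (hf : Flag v a b) :
    ∃ F ∈ P.faces, polygonVertices F = {φ v, φ a, φ b} :=
  (h.mem_faces _).2 ⟨v, a, b, hf, rfl⟩

theorem eq_convexHull {F : Set E3} {S : Set E3} (hF : F ∈ P.faces) (hS : polygonVertices F = S) :
    convexHull ℝ S = F := by
  rw [← hS, (P.isConvexPolygon F hF).convexHull_polygonVertices]

/-- The two faces have only the vertex `φ v` in common, hence meet only there. An edge opposite to
it misses `φ v`, which is an extreme point of the face. -/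
theorem disjoint (h : IsPlacement P φ) {v a b c d : Fin 24} (hab : Flag v a b)
    (hcd : Flag v c d) (hac : a ≠ c) (had : a ≠ d) (hbc : b ≠ c) (hbd : b ≠ d) :
    Disjoint (segment ℝ (φ a) (φ b)) (segment ℝ (φ c) (φ d)) := by
  obtain ⟨F, hF, hFv⟩ := h.exists_face hab
  obtain ⟨G, hG, hGv⟩ := h.exists_face hcd
  have hinter : polygonVertices F ∩ polygonVertices G = {φ v} := by
    rw [hFv, hGv]
    ext x
    simp only [Set.mem_inter_iff, Set.mem_insert_iff, Set.mem_singleton_iff]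
    constructor
    · rintro ⟨rfl | rfl | rfl, h2⟩
      · rfl
      · simpa [h.injective.eq_iff, hac, had] using h2
      · simpa [h.injective.eq_iff, hbc, hbd] using h2
    · rintro rfl
      simp
  have hne : F ≠ G := by
    rintro rfl
    rw [Set.inter_self, hFv] at hinter
    have : φ a ∈ ({φ v} : Set E3) := hinter ▸ by simp
    exact hab.ne.1 (h.injective this).symm
  rw [Set.disjoint_left]
  intro x hx hy
  have sub : ∀ {F a b}, F ∈ P.faces → a ∈ polygonVertices F → b ∈ polygonVertices F →
      segment ℝ a b ⊆ F := by
    intro F a b hF ha hb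
    rw [← (P.isConvexPolygon F hF).convexHull_polygonVertices]
    exact (convex_convexHull ℝ _).segment_subset (subset_convexHull ℝ _ ha)
      (subset_convexHull ℝ _ hb)
  have haF : φ a ∈ polygonVertices F := by simp [hFv]
  have hbF : φ b ∈ polygonVertices F := by simp [hFv]
  have hvF : φ v ∈ polygonVertices F := by simp [hFv]
  have := P.mem_convexHull_inter hF hG hne ⟨sub hF haF hbF hx,
    sub hG (by simp [hGv]) (by simp [hGv]) hy⟩
  rw [hinter, convexHull_singleton] at this
  rw [Set.mem_singleton_iff.1 this] at hx
  rcases (mem_extremePoints_iff_forall_segment.1 hvF).2 _ (extremePoints_subset haF) _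
    (extremePoints_subset hbF) hx with he | he
  · exact hab.ne.1 (h.injective he).symm
  · exact hab.ne.2.1 (h.injective he).symm

/-- The automorphisms that are induced by symmetries. -/
def inducedGroup (P : Polyhedron) (φ : Fin 24 → E3) : Subgroup (Equiv.Perm (Fin 24)) where
  carrier := {π | ∃ g ∈ P.symmetryGroup, ∀ v, g (φ v) = φ (π v)}
  one_mem' := ⟨1, P.symmetryGroup.one_mem, fun _ => rfl⟩
  mul_mem' := by
    rintro π σ ⟨g, hg, hgπ⟩ ⟨f, hf, hfσ⟩
    refine ⟨g * f, P.symmetryGroup.mul_mem hg hf, fun v => ?_⟩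
    rw [Equiv.Perm.mul_apply, ← hgπ, ← hfσ]
    rfl
  inv_mem' := by
    rintro π ⟨g, hg, hgπ⟩
    refine ⟨g⁻¹, P.symmetryGroup.inv_mem hg, fun v => ?_⟩
    have : g⁻¹ (g (φ (π⁻¹ v))) = φ (π⁻¹ v) := g.symm_apply_apply _
    rw [← this, hgπ]
    simp

theorem image_flag (h : IsPlacement P φ) {g : Isom3} (hg : g ∈ P.symmetryGroup) {v a b : Fin 24}
    (hf : Flag v a b) : ∃ v' a' b', Flag v' a' b' ∧
      ({g (φ v), g (φ a), g (φ b)} : Set E3) = {φ v', φ a', φ b'} := by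
  obtain ⟨F, hF, hFv⟩ := h.exists_face hf
  refine (h.mem_faces _).1 ⟨g '' F, (hg F).2 hF, ?_⟩
  rw [image_polygonVertices, hFv, Set.image_insert_eq, Set.image_insert_eq, Set.image_singleton]

theorem exists_perm (h : IsPlacement P φ) {g : Isom3} (hg : g ∈ P.symmetryGroup) :
    ∃ π : Equiv.Perm (Fin 24), ∀ v, g (φ v) = φ (π v) := by
  have hex : ∀ v, ∃ w, g (φ v) = φ w := by
    intro v
    obtain ⟨v', a', b', -, he⟩ := h.image_flag hg (flag_link v 0)
    have hmem : g (φ v) ∈ ({φ v', φ a', φ b'} : Set E3) := he ▸ by simp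
    rcases hmem with hm | hm | hm
    exacts [⟨_, hm⟩, ⟨_, hm⟩, ⟨_, hm⟩]
  choose f hf using hex
  have hinj : Function.Injective f := by
    intro v w hvw
    apply h.injective
    apply g.injective
    rw [hf, hf, hvw]
  exact ⟨Equiv.ofBijective f (Finite.injective_iff_bijective.1 hinj), hf⟩

theorem flag_perm (h : IsPlacement P φ) {g : Isom3} (hg : g ∈ P.symmetryGroup)
    {π : Equiv.Perm (Fin 24)} (hπ : ∀ v, g (φ v) = φ (π v)) {v a b : Fin 24} (hf : Flag v a b) :
    Flag (π v) (π a) (π b) := by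
  obtain ⟨v', a', b', hf', he⟩ := h.image_flag hg hf
  obtain ⟨h1, h2, h3⟩ := hf.ne
  refine flag_of_insert_eq hf' ?_ (π.injective.ne h1) (π.injective.ne h2) (π.injective.ne h3)
  apply h.injective.image_injective
  simpa [Set.image_insert_eq, hπ] using he

theorem realizes (h : IsPlacement P φ) : Realizes φ (inducedGroup P φ) where
  injective := h.injective
  le_automorphisms := by
    intro π hπ v a b
    obtain ⟨g, hg, hgπ⟩ := hπ
    obtain ⟨f, hf, hfπ⟩ := (inducedGroup P φ).inv_mem ⟨g, hg, hgπ⟩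
    exact ⟨fun hflag => by simpa using h.flag_perm hf hfπ hflag, h.flag_perm hg hgπ⟩
  exists_isometry := by
    rintro π ⟨g, -, hg⟩
    exact ⟨g, hg⟩
  disjoint := fun v a b c d hab hcd => h.disjoint hab hcd

/-- Two faces with a common edge are fixed pointwise, and their union is not coplanar. -/
theorem eq_one_of_fixes (h : IsPlacement P φ) {g : Isom3} (hg : ∀ v, g (φ v) = φ v) : g = 1 := by
  obtain ⟨F, hF, hFv⟩ := h.exists_face (flag_link 0 0)
  obtain ⟨G, hG, hGv⟩ := h.exists_face (flag_link 0 1)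
  have hFe := eq_convexHull hF hFv
  have hGe := eq_convexHull hG hGv
  have hne : F ≠ G := by
    rintro rfl
    have : φ (link 0 0) ∈ polygonVertices F := by simp [hFv]
    rw [hGv] at this
    have : link 0 0 ∈ ({0, link 0 1, link 0 (1 + 1)} : Set (Fin 24)) := by
      simpa [h.injective.eq_iff] using this
    revert this
    decide +kernel
  have hsub : ∀ {F}, F ∈ P.faces → polygonVertices F ⊆ F := fun _ => extremePoints_subset
  have hcop := P.not_coplanar_of_mem hF hG hne (h.injective.ne (flag_link 0 0).ne.2.1)
    ⟨hsub hF (by simp [hFv]), hsub hG (by simp [hGv])⟩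
    ⟨hsub hF (by simp [hFv]), hsub hG (by simp [hGv])⟩
  refine isometry_eq_one_of_not_coplanar hcop ?_
  have hfix : ∀ S : Set E3, (∀ x ∈ S, g x = x) → ∀ x ∈ convexHull ℝ S, g x = x := by
    intro S hS
    apply convexHull_min hS
    intro x hx y hy a b _ _ hab
    have := Convex.combo_affine_apply (f := g.toAffineEquiv.toAffineMap) (x := x) (y := y) hab
    change g (a • x + b • y) = a • g x + b • g y at this
    change g (a • x + b • y) = a • x + b • y
    rw [this, hx, hy]
  rintro x (hx | hx)
  · rw [← hFe] at hx
    refine hfix _ ?_ x hx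
    rintro _ (rfl | rfl | rfl) <;> exact hg _
  · rw [← hGe] at hx
    refine hfix _ ?_ x hx
    rintro _ (rfl | rfl | rfl) <;> exact hg _

theorem exists_injective (h : IsPlacement P φ) :
    ∃ f : P.symmetryGroup → inducedGroup P φ, Function.Injective f := by
  choose π hπ using fun g : P.symmetryGroup => h.exists_perm g.2
  refine ⟨fun g => ⟨π g, g, g.2, hπ g⟩, ?_⟩
  intro g f hgf
  have hgf' : π g = π f := congrArg Subtype.val hgf
  have : (f⁻¹ * g : Isom3) = 1 := by
    apply h.eq_one_of_fixes
    intro v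
    have h1 : (f : Isom3)⁻¹ ((f : Isom3) (φ v)) = φ v := f.1.symm_apply_apply _
    rw [hπ f, ← hgf', ← hπ g] at h1
    exact h1
  exact Subtype.ext (inv_mul_eq_one.1 this).symm

end IsPlacement

end FrickeKlein

/-- The symmetry group of a polyhedral embedding has at most 24 elements. -/
theorem Polyhedron.IsEmbeddingOf.card_symmetryGroup_le {P : Polyhedron}
    (hP : P.IsEmbeddingOf frickeKleinMap) :
    Finite P.symmetryGroup ∧ Nat.card P.symmetryGroup ≤ 24 := by
  obtain ⟨φ, h⟩ := FrickeKlein.exists_placement hP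
  obtain ⟨f, hf⟩ := h.exists_injective
  exact ⟨Finite.of_injective f hf, (Nat.card_le_card_of_injective f hf).trans h.realizes.card_le⟩

/-! ### The octahedral groups -/

namespace Octahedron

/-- The isometry that permutes the coordinates and changes their signs. -/
noncomputable def signedIsometry (p : Equiv.Perm (Fin 3)) (s : Fin 3 → ℤˣ) : E3 ≃ₗᵢ[ℝ] E3 where
  toFun x := WithLp.toLp 2 fun i => ((s i : ℤ) : ℝ) * x (p i)
  invFun x := WithLp.toLp 2 fun i => ((s (p.symm i) : ℤ) : ℝ) * x (p.symm i)
  map_add' x y := by ext i; simp [mul_add]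
  map_smul' c x := by ext i; simp; ring
  left_inv x := by
    ext i
    rcases Int.units_eq_one_or (s (p.symm i)) with h | h <;> simp [h]
  right_inv x := by
    ext i
    rcases Int.units_eq_one_or (s i) with h | h <;> simp [h]
  norm_map' x := by
    change ‖(WithLp.toLp 2 fun i => ((s i : ℤ) : ℝ) * x (p i) : E3)‖ = ‖x‖
    rw [EuclideanSpace.norm_eq, EuclideanSpace.norm_eq]
    congr 1
    rw [← Equiv.sum_comp p fun i => ‖x i‖ ^ 2]
    refine Finset.sum_congr rfl fun i _ => ?_
    rcases Int.units_eq_one_or (s i) with h | h <;> simp [h]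

theorem signedIsometry_apply (p : Equiv.Perm (Fin 3)) (s : Fin 3 → ℤˣ) (x : E3) (i : Fin 3) :
    signedIsometry p s x i = ((s i : ℤ) : ℝ) * x (p i) := rfl

theorem det_signedIsometry (p : Equiv.Perm (Fin 3)) (s : Fin 3 → ℤˣ) :
    LinearMap.det (signedIsometry p s : E3 →ₗ[ℝ] E3) =
      ((Equiv.Perm.sign p * ∏ i, s i : ℤˣ) : ℤ) := by
  let b := (EuclideanSpace.basisFun (Fin 3) ℝ).toBasis
  rw [← LinearMap.det_toMatrix b]
  have h : LinearMap.toMatrix b b (signedIsometry p s : E3 →ₗ[ℝ] E3) =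
      Matrix.of fun i j => ((s i : ℤ) : ℝ) * (p.permMatrix ℝ) i j := by
    ext i j
    rw [LinearMap.toMatrix_apply]
    simp [b, signedIsometry_apply, Equiv.Perm.permMatrix, PEquiv.toMatrix_apply, eq_comm]
  rw [h, Matrix.det_mul_column, Matrix.det_permutation, mul_comm]
  push_cast
  rfl

/-- A signed permutation of the coordinates, as an isometry of the affine space. -/
noncomputable def signedIsom (p : Equiv.Perm (Fin 3)) (s : Fin 3 → ℤˣ) : Isom3 :=
  (signedIsometry p s).toAffineIsometryEquiv

theorem signedIsom_apply (p : Equiv.Perm (Fin 3)) (s : Fin 3 → ℤˣ) (x : E3) (i : Fin 3) :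
    signedIsom p s x i = ((s i : ℤ) : ℝ) * x (p i) := rfl

theorem mem_octahedronVertices {x : E3} :
    x ∈ octahedronVertices ↔ ∃ (i : Fin 3) (e : ℤˣ), x = EuclideanSpace.single i ((e : ℤ) : ℝ) := by
  constructor
  · rintro ⟨i, h | h⟩
    · exact ⟨i, 1, by simpa using h⟩
    · exact ⟨i, -1, by simpa using h⟩
  · rintro ⟨i, e, rfl⟩
    rcases Int.units_eq_one_or e with rfl | rfl
    · exact ⟨i, Or.inl (by simp)⟩
    · exact ⟨i, Or.inr (by simp)⟩

theorem signedIsom_mem (p : Equiv.Perm (Fin 3)) (s : Fin 3 → ℤˣ) :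
    signedIsom p s ∈ fullOctahedralGroup := by
  intro x
  rw [mem_octahedronVertices, mem_octahedronVertices]
  constructor
  · rintro ⟨i, e, h⟩
    refine ⟨p i, s i * e, ?_⟩
    ext j
    have hj := congrArg (fun y : E3 => y (p.symm j)) h
    simp only [signedIsom_apply, Equiv.apply_symm_apply, PiLp.single_apply] at hj ⊢
    by_cases hji : p.symm j = i
    · subst hji
      rw [if_pos rfl] at hj
      rw [Equiv.apply_symm_apply, if_pos rfl, Units.val_mul, Int.cast_mul, ← hj, ← mul_assoc]
      rcases Int.units_eq_one_or (s (p.symm j)) with h | h <;> simp [h]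
    · rw [if_neg hji] at hj
      rw [if_neg (fun h => hji (by rw [h, Equiv.symm_apply_apply]))]
      rcases Int.units_eq_one_or (s (p.symm j)) with h | h <;> simpa [h] using hj
  · rintro ⟨i, e, rfl⟩
    refine ⟨p.symm i, s (p.symm i) * e, ?_⟩
    ext j
    rw [signedIsom_apply]
    simp only [PiLp.single_apply]
    by_cases hji : p j = i
    · subst hji
      simp
    · rw [if_neg hji, if_neg (fun h => hji (by rw [h, Equiv.apply_symm_apply])), mul_zero]

/-- Vertices of the octahedron that are not opposite either coincide or have squared distance 2. -/
theorem dist_single_lt {i j : Fin 3} {a b : ℤˣ}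
    (h : EuclideanSpace.single i ((a : ℤ) : ℝ) + EuclideanSpace.single j ((b : ℤ) : ℝ) ≠ (0 : E3)) :
    dist (EuclideanSpace.single i ((a : ℤ) : ℝ) : E3) (EuclideanSpace.single j ((b : ℤ) : ℝ)) ^ 2
      < 4 := by
  rw [EuclideanSpace.dist_eq, Real.sq_sqrt (Finset.sum_nonneg fun _ _ => sq_nonneg _)]
  by_cases hij : i = j
  · subst hij
    rcases Int.units_eq_one_or a with rfl | rfl <;> rcases Int.units_eq_one_or b with rfl | rfl
    · simp
    · exact absurd (by ext k; by_cases hk : k = i <;> simp [hk]) h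
    · exact absurd (by ext k; by_cases hk : k = i <;> simp [hk]) h
    · simp
  · rw [Fin.sum_univ_three]
    fin_cases i <;> fin_cases j <;> first | exact absurd rfl hij | skip
    all_goals
      rcases Int.units_eq_one_or a with rfl | rfl <;>
      rcases Int.units_eq_one_or b with rfl | rfl <;>
      simp [Real.dist_eq] <;> norm_num

/-- The images of two opposite vertices still have distance 2, so they are opposite again, and their
midpoint is preserved. -/
theorem map_zero_of_mem {g : Isom3} (hg : g ∈ fullOctahedralGroup) : g 0 = 0 := by
  have h1 : g (EuclideanSpace.single 0 ((1 : ℤˣ) : ℤ)) ∈ octahedronVertices :=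
    (hg _).2 (mem_octahedronVertices.2 ⟨0, 1, rfl⟩)
  have h2 : g (EuclideanSpace.single 0 ((-1 : ℤˣ) : ℤ)) ∈ octahedronVertices :=
    (hg _).2 (mem_octahedronVertices.2 ⟨0, -1, rfl⟩)
  obtain ⟨i, a, hi⟩ := mem_octahedronVertices.1 h1
  obtain ⟨j, b, hj⟩ := mem_octahedronVertices.1 h2
  have hd : dist (g (EuclideanSpace.single 0 ((1 : ℤˣ) : ℤ)))
      (g (EuclideanSpace.single 0 ((-1 : ℤˣ) : ℤ))) ^ 2 = 4 := by
    rw [g.dist_map, EuclideanSpace.dist_eq,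
      Real.sq_sqrt (Finset.sum_nonneg fun _ _ => sq_nonneg _), Fin.sum_univ_three]
    simp [Real.dist_eq]
    norm_num
  have hsum : g (EuclideanSpace.single 0 ((1 : ℤˣ) : ℤ)) +
      g (EuclideanSpace.single 0 ((-1 : ℤˣ) : ℤ)) = 0 := by
    by_contra hne
    rw [hi, hj] at hne hd
    exact (dist_single_lt hne).ne hd
  have hmid : g (midpoint ℝ _ _) = midpoint ℝ (g _) (g _) :=
    g.toAffineEquiv.map_midpoint (EuclideanSpace.single 0 ((1 : ℤˣ) : ℤ))
      (EuclideanSpace.single 0 ((-1 : ℤˣ) : ℤ))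
  rw [midpoint_eq_smul_add, midpoint_eq_smul_add, hsum, smul_zero] at hmid
  have hz : (EuclideanSpace.single 0 (((1 : ℤˣ) : ℤ) : ℝ) : E3) +
      EuclideanSpace.single 0 (((-1 : ℤˣ) : ℤ) : ℝ) = 0 := by
    ext k
    by_cases hk : k = 0 <;> simp [hk]
  rwa [hz, smul_zero] at hmid

theorem exists_signedIsom {g : Isom3} (hg : g ∈ fullOctahedralGroup) :
    ∃ p s, g = signedIsom p s := by
  have h0 := map_zero_of_mem hg
  have hL : ∀ x, g x = g.linearIsometryEquiv x := by
    intro x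
    have := g.map_vadd 0 x
    simpa [h0] using this
  have hv : ∀ j : Fin 3, ∃ (i : Fin 3) (e : ℤˣ), g.linearIsometryEquiv (EuclideanSpace.single j 1) =
      EuclideanSpace.single i ((e : ℤ) : ℝ) := by
    intro j
    rw [← hL]
    exact mem_octahedronVertices.1 ((hg _).2 ⟨j, Or.inl rfl⟩)
  choose q e hq using hv
  -- Orthogonal basis vectors cannot be sent to the same coordinate axis.
  have hinj : Function.Injective q := by
    intro j k hjk
    by_contra hne
    have h1 := g.linearIsometryEquiv.inner_map_map (EuclideanSpace.single j (1 : ℝ))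
      (EuclideanSpace.single k (1 : ℝ))
    rw [hq, hq, hjk, EuclideanSpace.inner_single_left, EuclideanSpace.inner_single_left] at h1
    have hne' : k ≠ j := fun h => hne h.symm
    rcases Int.units_eq_one_or (e j) with h | h <;>
      rcases Int.units_eq_one_or (e k) with h' | h' <;> simp [h, h', hne] at h1
  let p : Equiv.Perm (Fin 3) := (Equiv.ofBijective q (Finite.injective_iff_bijective.1 hinj)).symm
  have hpq : ∀ j, p (q j) = j := fun j => Equiv.ofBijective_symm_apply_apply q _ j
  -- `signedIsometry` is indexed by the coordinate of the image, whence the inverse `p` of `q` and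
  -- the sign at `p i`.
  refine ⟨p, fun i => e (p i), ?_⟩
  have hlin : (g.linearIsometryEquiv : E3 →ₗ[ℝ] E3) =
      (signedIsometry p fun i => e (p i) : E3 →ₗ[ℝ] E3) := by
    refine (EuclideanSpace.basisFun (Fin 3) ℝ).toBasis.ext fun j => ?_
    rw [OrthonormalBasis.coe_toBasis, EuclideanSpace.basisFun_apply]
    change g.linearIsometryEquiv _ = signedIsometry _ _ _
    rw [hq]
    ext i
    rw [signedIsometry_apply]
    simp only [PiLp.single_apply]
    by_cases hi : i = q j
    · subst hi
      simp [hpq]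
    · rw [if_neg hi, if_neg, mul_zero]
      intro h
      apply hi
      apply p.injective
      rw [h, hpq]
  ext1 x
  rw [hL]
  exact LinearMap.congr_fun hlin x

theorem signedIsom_injective {p q : Equiv.Perm (Fin 3)} {s t : Fin 3 → ℤˣ}
    (h : signedIsom p s = signedIsom q t) : p = q ∧ s = t := by
  have key : ∀ i, p i = q i ∧ s i = t i := by
    intro i
    have h1 := congrArg (fun g : Isom3 => g (EuclideanSpace.single (p i) 1) i) h
    simp only [signedIsom_apply, PiLp.single_apply, if_pos] at h1
    by_cases hi : p i = q i
    · refine ⟨hi, ?_⟩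
      rw [if_pos hi.symm, mul_one, mul_one] at h1
      exact Units.ext (by exact_mod_cast h1)
    · rw [if_neg (Ne.symm hi), mul_one, mul_zero] at h1
      rcases Int.units_eq_one_or (s i) with h | h <;> simp [h] at h1
  exact ⟨Equiv.ext fun i => (key i).1, funext fun i => (key i).2⟩

theorem signedIsom_mem_rotationGroup {p : Equiv.Perm (Fin 3)} {s : Fin 3 → ℤˣ} :
    signedIsom p s ∈ octahedralRotationGroup ↔ Equiv.Perm.sign p * ∏ i, s i = 1 := by
  have hdet : LinearMap.det ((signedIsom p s).linearIsometryEquiv : E3 →ₗ[ℝ] E3) =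
      ((Equiv.Perm.sign p * ∏ i, s i : ℤˣ) : ℤ) := det_signedIsometry p s
  constructor
  · rintro ⟨-, h⟩
    rw [hdet] at h
    exact Units.ext (Int.cast_injective (h.trans Int.cast_one.symm))
  · intro h
    refine ⟨signedIsom_mem p s, ?_⟩
    rw [hdet, h]
    simp

theorem card_octahedralRotationGroup : Nat.card octahedralRotationGroup = 24 := by
  let S := {x : Equiv.Perm (Fin 3) × (Fin 3 → ℤˣ) // Equiv.Perm.sign x.1 * ∏ i, x.2 i = 1}
  let f : S → octahedralRotationGroup := fun x =>
    ⟨signedIsom x.1.1 x.1.2, signedIsom_mem_rotationGroup.2 x.2⟩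
  have hf : Function.Bijective f := by
    constructor
    · rintro ⟨⟨p, s⟩, h⟩ ⟨⟨q, t⟩, h'⟩ he
      obtain ⟨rfl, rfl⟩ := signedIsom_injective (congrArg Subtype.val he)
      rfl
    · rintro ⟨g, hg⟩
      obtain ⟨p, s, rfl⟩ := exists_signedIsom hg.1
      exact ⟨⟨(p, s), signedIsom_mem_rotationGroup.1 hg⟩, rfl⟩
  rw [← Nat.card_congr (Equiv.ofBijective f hf), Nat.card_eq_fintype_card]
  decide +kernel

/-- The full octahedral group has more than 24 elements. -/
theorem card_fullOctahedralGroup_gt [Finite fullOctahedralGroup] :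
    24 < Nat.card fullOctahedralGroup := by
  by_contra! hle
  rw [← card_octahedralRotationGroup] at hle
  have heq : octahedralRotationGroup = fullOctahedralGroup :=
    Subgroup.eq_of_le_of_card_ge (fun g hg => hg.1) hle
  -- The point reflection preserves the octahedron but has determinant -1.
  have h1 : signedIsom 1 (fun _ => -1) ∈ octahedralRotationGroup :=
    heq ▸ signedIsom_mem 1 fun _ => -1
  rw [signedIsom_mem_rotationGroup] at h1
  revert h1
  decide

end Octahedron

theorem Polyhedron.IsEmbeddingOf.not_fullOctahedralGroupAt_le {P : Polyhedron}
    (hP : P.IsEmbeddingOf frickeKleinMap) (h : Isom3) :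
    ¬ fullOctahedralGroupAt h ≤ P.symmetryGroup := by
  intro hle
  obtain ⟨hfin, hcard⟩ := hP.card_symmetryGroup_le
  have e : fullOctahedralGroup ≃ fullOctahedralGroupAt h :=
    (fullOctahedralGroup.equivMapOfInjective _ (MulAut.conj h).injective).toEquiv
  have hinj := Subgroup.inclusion_injective hle
  have : Finite (fullOctahedralGroupAt h) := Finite.of_injective _ hinj
  have : Finite fullOctahedralGroup := Finite.of_equiv _ e.symm
  have h1 := Nat.card_le_card_of_injective _ hinj
  rw [← Nat.card_congr e] at h1
  have h2 := Octahedron.card_fullOctahedralGroup_gt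
  omega

/-! ### Separation of the faces spanned by the labels -/

namespace FrickeKlein

def dot (n x : Fin 3 → ℤ) : ℤ := n 0 * x 0 + n 1 * x 1 + n 2 * x 2

def cross (x y : Fin 3 → ℤ) : Fin 3 → ℤ
  | 0 => x 1 * y 2 - x 2 * y 1
  | 1 => x 2 * y 0 - x 0 * y 2
  | 2 => x 0 * y 1 - x 1 * y 0

/-- The vertices of a face at `v`. -/
def tri (v : Fin 24) (j : Fin 8) : Fin 3 → Fin 24
  | 0 => v
  | 1 => link v j
  | 2 => link v (j + 1)

/-- The functional `n` is at least as large on the vertices of `f` as on those of `g`, and larger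
on those that `f` does not share with `g`. -/
def Separates (n : Fin 3 → ℤ) (f g : Fin 3 → Fin 24) : Prop :=
  ∀ a b, dot n (label (g b)) ≤ dot n (label (f a)) ∧
    ((∃ c, f a = g c) ∨ dot n (label (g b)) < dot n (label (f a)))

instance (n : Fin 3 → ℤ) (f g : Fin 3 → Fin 24) : Decidable (Separates n f g) := by
  unfold Separates; infer_instance

def edgeVector (f : Fin 3 → Fin 24) (a i : Fin 3) : ℤ := label (f (a + 1)) i - label (f a) i

/-- One of the functionals `n` and `-n` separates the two triangles. -/
def SeparatesUpToSign (n : Fin 3 → ℤ) (f g : Fin 3 → Fin 24) : Prop :=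
  Separates n f g ∨ Separates n g f ∨ Separates (-n) f g ∨ Separates (-n) g f

instance (n : Fin 3 → ℤ) (f g : Fin 3 → Fin 24) : Decidable (SeparatesUpToSign n f g) := by
  unfold SeparatesUpToSign; infer_instance

/-- Two triangles are separated by a normal vector of one of them, or by the vector product of two
edges. -/
theorem separatesUpToSign_tri : ∀ v w : Fin 24, v ≤ w →
    ∀ j : Fin 8, v < link v j → v < link v (j + 1) →
    ∀ k : Fin 8, w < link w k → w < link w (k + 1) → (v = w → j ≠ k) →
      SeparatesUpToSign (cross (edgeVector (tri v j) 0) (edgeVector (tri v j) 1))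
        (tri v j) (tri w k) ∨
      SeparatesUpToSign (cross (edgeVector (tri w k) 0) (edgeVector (tri w k) 1))
        (tri v j) (tri w k) ∨
      ∃ a b, SeparatesUpToSign (cross (edgeVector (tri v j) a) (edgeVector (tri w k) b))
        (tri v j) (tri w k) := by
  decide +kernel

theorem exists_separates_tri {v w : Fin 24} {j k : Fin 8} (h1 : v < link v j)
    (h2 : v < link v (j + 1)) (h3 : w < link w k) (h4 : w < link w (k + 1))
    (h : v = w → j ≠ k) :
    ∃ n, Separates n (tri v j) (tri w k) ∨ Separates n (tri w k) (tri v j) := by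
  have key : ∀ {n f g}, SeparatesUpToSign n f g → ∃ n, Separates n f g ∨ Separates n g f := by
    rintro n f g (h | h | h | h)
    exacts [⟨n, Or.inl h⟩, ⟨n, Or.inr h⟩, ⟨-n, Or.inl h⟩, ⟨-n, Or.inr h⟩]
  rcases le_total v w with hvw | hvw
  · obtain h | h | ⟨a, b, h⟩ := separatesUpToSign_tri v w hvw j h1 h2 k h3 h4 h
    exacts [key h, key h, key h]
  · obtain h | h | ⟨a, b, h⟩ := separatesUpToSign_tri w v hvw k h3 h4 j h1 h2
      fun e => (h e.symm).symm
    all_goals exact (key h).imp fun n hn => hn.symm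

/-- No face plane passes through the origin. Hence the vertices of a face form a basis of space,
whose linear coordinates are barycentric coordinates on the face. -/
theorem det_tri_ne_zero : ∀ v j,
    dot (cross (label (tri v j 0)) (label (tri v j 1))) (label (tri v j 2)) ≠ 0 := by
  decide +kernel

/-- The four vertices of two adjacent faces are affinely independent. -/
theorem det_adjacent_ne_zero : ∀ v i,
    dot (cross (label (link v i) - label v) (label (link v (i + 1)) - label v))
      (label (link v (i - 1)) - label v) ≠ 0 := by
  decide +kernel

end FrickeKlein

/-! ### Simplices spanned by a basis -/

section Simplex

variable {ι E : Type*} [Fintype ι] [AddCommGroup E] [Module ℝ E] (b : Module.Basis ι ℝ E)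

theorem mem_convexHull_basis_image {I : Set ι} {p : E} :
    p ∈ convexHull ℝ (b '' I) ↔
      (∀ i, 0 ≤ b.repr p i) ∧ ∑ i, b.repr p i = 1 ∧ ∀ i ∉ I, b.repr p i = 0 := by
  constructor
  · intro hp
    have hconv : Convex ℝ {p : E | (∀ i, 0 ≤ b.repr p i) ∧ ∑ i, b.repr p i = 1 ∧
        ∀ i ∉ I, b.repr p i = 0} := by
      rintro x ⟨hx, hx', hx''⟩ y ⟨hy, hy', hy''⟩ s t hs ht hst
      refine ⟨fun i => ?_, ?_, fun i hi => ?_⟩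
      · simpa using add_nonneg (mul_nonneg hs (hx i)) (mul_nonneg ht (hy i))
      · simp [Finset.sum_add_distrib, ← Finset.mul_sum, hx', hy', hst]
      · simp [hx'' i hi, hy'' i hi]
    refine convexHull_min ?_ hconv hp
    rintro _ ⟨j, hj, rfl⟩
    refine ⟨fun i => ?_, ?_, fun i hi => ?_⟩
    · rw [b.repr_self]
      exact Finsupp.single_nonneg.2 zero_le_one i
    · classical simp [Finsupp.single_apply]
    · rw [b.repr_self, Finsupp.single_eq_of_ne]
      rintro rfl
      exact hi hj
  · rintro ⟨h0, h1, hI⟩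
    classical
    rw [← b.sum_repr p, ← Finset.sum_subset (Finset.subset_univ (Finset.univ.filter (· ∈ I)))]
    · refine (convex_convexHull ℝ _).sum_mem (fun i _ => h0 i) ?_ ?_
      · rw [← h1, Finset.sum_subset (Finset.subset_univ _)]
        intro i _ hi
        exact hI i (by simpa using hi)
      · intro i hi
        exact subset_convexHull ℝ _ ⟨i, by simpa using hi, rfl⟩
    · intro i _ hi
      rw [hI i (by simpa using hi), zero_smul]

/-- A coordinate that vanishes at an inner point of a segment vanishes at its ends, since all
coordinates are nonnegative. -/
theorem isExtreme_convexHull_basis_image {I J : Set ι} (hIJ : I ⊆ J) :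
    IsExtreme ℝ (convexHull ℝ (b '' J)) (convexHull ℝ (b '' I)) := by
  refine ⟨convexHull_mono (Set.image_mono hIJ), ?_⟩
  rintro x hx y hy _ hz ⟨s, t, hs, ht, hst, rfl⟩
  rw [mem_convexHull_basis_image] at hx hy hz ⊢
  refine ⟨hx.1, hx.2.1, fun i hi => ?_⟩
  have h := hz.2.2 i hi
  simp only [map_add, map_smul, Finsupp.coe_add, Finsupp.coe_smul, Pi.add_apply, Pi.smul_apply,
    smul_eq_mul] at h
  nlinarith [hx.1 i, hy.1 i, mul_nonneg hs.le (hx.1 i), mul_nonneg ht.le (hy.1 i)]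

theorem extremePoints_convexHull_basis_image (I : Set ι) :
    (convexHull ℝ (b '' I)).extremePoints ℝ = b '' I := by
  refine extremePoints_convexHull_subset.antisymm ?_
  rintro _ ⟨i, hi, rfl⟩
  rw [← isExtreme_singleton, ← convexHull_singleton (𝕜 := ℝ) (b i), ← Set.image_singleton]
  exact isExtreme_convexHull_basis_image b (Set.singleton_subset_iff.2 hi)

/-- A point of a simplex at which a functional is minimal lies in the face spanned by the vertices
at which it is minimal. -/
theorem mem_convexHull_basis_image_of_le {I : Set ι} (n : E →ₗ[ℝ] ℝ) {m : ℝ}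
    (hm : ∀ i, m ≤ n (b i)) (hI : ∀ i ∉ I, m < n (b i)) {p : E}
    (hp : p ∈ convexHull ℝ (Set.range b)) (hn : n p ≤ m) : p ∈ convexHull ℝ (b '' I) := by
  rw [← Set.image_univ, mem_convexHull_basis_image] at hp
  refine (mem_convexHull_basis_image b).2 ⟨hp.1, hp.2.1, fun i hi => ?_⟩
  -- The excess of `n p` over `m` is a sum of nonnegative terms, so every vertex with a positive gap
  -- has weight zero.
  have h1 : n p - m = ∑ i, b.repr p i * (n (b i) - m) := by
    conv_lhs => rw [← b.sum_repr p]
    simp only [map_sum, map_smul, smul_eq_mul, mul_sub, Finset.sum_sub_distrib]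
    rw [← Finset.sum_mul, hp.2.1, one_mul]
  have h2 : b.repr p i * (n (b i) - m) ≤ n p - m := by
    rw [h1]
    exact Finset.single_le_sum (f := fun i => b.repr p i * (n (b i) - m))
      (fun j _ => mul_nonneg (hp.1 j) (sub_nonneg.2 (hm j))) (Finset.mem_univ i)
  nlinarith [hI i hi, hp.1 i]

end Simplex

/-! ### The polyhedron whose vertices are the labels -/

namespace FrickeKlein

/-- The integer points as points of space. -/
noncomputable def toSpace (x : Fin 3 → ℤ) : E3 := WithLp.toLp 2 fun i => (x i : ℝ)

theorem toSpace_apply (x : Fin 3 → ℤ) (i : Fin 3) : toSpace x i = x i := rfl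

theorem toSpace_injective : Function.Injective toSpace := by
  intro x y h
  funext i
  exact Int.cast_injective (α := ℝ) (congrArg (fun z : E3 => z i) h)

theorem toSpace_sub (x y : Fin 3 → ℤ) : toSpace (x - y) = toSpace x - toSpace y := by
  ext i
  simp [toSpace_apply]

theorem inner_toSpace (x y : Fin 3 → ℤ) : inner ℝ (toSpace x) (toSpace y) = (dot x y : ℝ) := by
  rw [PiLp.inner_apply, Fin.sum_univ_three]
  simp [toSpace_apply, dot]
  ring

theorem linearIndependent_toSpace {x : Fin 3 → Fin 3 → ℤ}
    (h : dot (cross (x 0) (x 1)) (x 2) ≠ 0) : LinearIndependent ℝ fun i => toSpace (x i) := by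
  refine LinearIndependent.of_comp (WithLp.linearEquiv 2 ℝ (Fin 3 → ℝ)).toLinearMap ?_
  refine Matrix.linearIndependent_rows_of_det_ne_zero
    (A := Matrix.of fun i j => ((x i j : ℤ) : ℝ)) ?_
  rw [Matrix.det_fin_three]
  simp only [Matrix.of_apply]
  have e : dot (cross (x 0) (x 1)) (x 2) = x 0 0 * x 1 1 * x 2 2 - x 0 0 * x 1 2 * x 2 1 -
      x 0 1 * x 1 0 * x 2 2 + x 0 1 * x 1 2 * x 2 0 + x 0 2 * x 1 0 * x 2 1 -
      x 0 2 * x 1 1 * x 2 0 := by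
    simp only [dot, cross]
    ring
  rw [e] at h
  exact_mod_cast h

noncomputable def point (v : Fin 24) : E3 := toSpace (label v)

theorem point_injective : Function.Injective point := toSpace_injective.comp label_injective

def IsFace (S : Finset (Fin 24)) : Prop := ∃ v a b, Flag v a b ∧ S = {v, a, b}

noncomputable def hull (S : Finset (Fin 24)) : Set E3 := convexHull ℝ (point '' S)

theorem hull_pair (v w : Fin 24) : hull {v, w} = segment ℝ (point v) (point w) := by
  rw [hull, Finset.coe_pair, Set.image_pair, convexHull_pair]

theorem image_tri (v : Fin 24) (j : Fin 8) :
    Finset.univ.image (tri v j) = {v, link v j, link v (j + 1)} := by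
  have h : (Finset.univ : Finset (Fin 3)) = {0, 1, 2} := rfl
  rw [h, Finset.image_insert, Finset.image_insert, Finset.image_singleton]
  rfl

namespace IsFace

variable {S T : Finset (Fin 24)}

theorem of_link (v : Fin 24) (j : Fin 8) : IsFace {v, link v j, link v (j + 1)} :=
  ⟨v, _, _, flag_link v j, rfl⟩

theorem exists_link (hS : IsFace S) {v : Fin 24} (hv : v ∈ S) :
    ∃ j, S = {v, link v j, link v (j + 1)} := by
  obtain ⟨x, a, b, hf, rfl⟩ := hS
  have key : ∀ {x a b}, Flag x a b → ∃ j,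
      ({x, a, b} : Finset (Fin 24)) = {x, link x j, link x (j + 1)} := by
    rintro x a b ⟨j, ⟨rfl, rfl⟩ | ⟨rfl, rfl⟩⟩
    · exact ⟨j, rfl⟩
    · exact ⟨j, by rw [Finset.pair_comm]⟩
  have rotate : ∀ x a b : Fin 24, ({x, a, b} : Finset (Fin 24)) = {a, b, x} := by
    intro x a b
    rw [Finset.insert_comm, Finset.pair_comm x b]
  rw [Finset.mem_insert, Finset.mem_insert, Finset.mem_singleton] at hv
  obtain rfl | rfl | rfl := hv
  · exact key hf
  · rw [rotate]
    exact key hf.rotate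
  · rw [rotate, rotate]
    exact key hf.rotate.rotate

theorem exists_tri (hS : IsFace S) : ∃ v j, v < link v j ∧ v < link v (j + 1) ∧
    S = Finset.univ.image (tri v j) := by
  obtain ⟨x, a, b, hf, rfl⟩ := hS
  obtain ⟨v, a', b', ⟨j, hj⟩, ha, hb, h⟩ := hf.exists_lt
  refine ⟨v, j, ?_⟩
  rw [h, image_tri]
  rcases hj with ⟨rfl, rfl⟩ | ⟨rfl, rfl⟩
  · exact ⟨ha, hb, rfl⟩
  · exact ⟨hb, ha, by rw [Finset.pair_comm]⟩

theorem card_eq (hS : IsFace S) : S.card = 3 := by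
  obtain ⟨v, a, b, hf, rfl⟩ := hS
  obtain ⟨h1, h2, h3⟩ := hf.ne
  exact Finset.card_eq_three.2 ⟨v, a, b, h1, h2, h3, rfl⟩

theorem exists_basis_tri (v : Fin 24) (j : Fin 8) :
    ∃ b : Module.Basis (Fin 3) ℝ E3, ∀ i, b i = point (tri v j i) := by
  have h := linearIndependent_toSpace (x := fun i => label (tri v j i)) (det_tri_ne_zero v j)
  exact ⟨basisOfLinearIndependentOfCardEqFinrank h (by simp), fun i => by simp [point]⟩

theorem exists_basis (hS : IsFace S) :
    ∃ b : Module.Basis (Fin 3) ℝ E3, Set.range b = point '' S := by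
  obtain ⟨v, j, -, -, rfl⟩ := hS.exists_tri
  obtain ⟨b, hb⟩ := exists_basis_tri v j
  refine ⟨b, ?_⟩
  rw [Finset.coe_image, Finset.coe_univ, Set.image_univ, ← Set.range_comp]
  exact congrArg Set.range (funext hb)

theorem isExtreme_hull (hS : IsFace S) (hT : T ⊆ S) : IsExtreme ℝ (hull S) (hull T) := by
  obtain ⟨b, hb⟩ := hS.exists_basis
  obtain ⟨I, hI⟩ := Set.subset_range_iff_exists_image_eq.1
    (hb ▸ Set.image_mono (f := point) (Finset.coe_subset.2 hT))
  rw [hull, hull, ← hI, ← hb, ← Set.image_univ]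
  exact isExtreme_convexHull_basis_image b (Set.subset_univ I)

theorem polygonVertices_hull (hS : IsFace S) : polygonVertices (hull S) = point '' S := by
  obtain ⟨b, hb⟩ := hS.exists_basis
  rw [polygonVertices, hull, ← hb, ← Set.image_univ, extremePoints_convexHull_basis_image]

theorem mem_polygonVertices_hull (hS : IsFace S) {v : Fin 24} :
    point v ∈ polygonVertices (hull S) ↔ v ∈ S := by
  rw [hS.polygonVertices_hull, point_injective.mem_set_image, Finset.mem_coe]

theorem hull_injective (hS : IsFace S) (hT : IsFace T) (h : hull S = hull T) : S = T := by
  ext v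
  rw [← hS.mem_polygonVertices_hull, h, hT.mem_polygonVertices_hull]

theorem isConvexPolygon_hull (hS : IsFace S) : IsConvexPolygon (hull S) := by
  refine ⟨⟨_, S.finite_toSet.image _, rfl⟩, ?_⟩
  obtain ⟨b, hb⟩ := hS.exists_basis
  rw [hull, ← direction_affineSpan, affineSpan_convexHull, direction_affineSpan, ← hb]
  exact b.linearIndependent.affineIndependent.finrank_vectorSpan (by simp)

theorem isPolygonEdge_hull (hS : IsFace S) {e : Set E3} :
    IsPolygonEdge e (hull S) ↔ ∃ v ∈ S, ∃ w ∈ S, v ≠ w ∧ e = hull {v, w} := by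
  constructor
  · rintro ⟨⟨x, y, hxy, rfl⟩, he⟩
    have hx : x ∈ polygonVertices (hull S) :=
      he.extremePoints_subset_extremePoints (left_mem_extremePoints_segment x y)
    have hy : y ∈ polygonVertices (hull S) := by
      refine he.extremePoints_subset_extremePoints ?_
      rw [segment_symm]
      exact left_mem_extremePoints_segment y x
    rw [hS.polygonVertices_hull] at hx hy
    obtain ⟨v, hv, rfl⟩ := hx
    obtain ⟨w, hw, rfl⟩ := hy
    exact ⟨v, hv, w, hw, fun h => hxy (h ▸ rfl), (hull_pair v w).symm⟩
  · rintro ⟨v, hv, w, hw, hvw, rfl⟩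
    refine ⟨⟨_, _, point_injective.ne hvw, hull_pair v w⟩, hS.isExtreme_hull ?_⟩
    simp [Finset.insert_subset_iff, hv, hw]

theorem isPolygonEdge_hull_pair (hS : IsFace S) {v w : Fin 24} (hvw : v ≠ w) :
    IsPolygonEdge (hull {v, w}) (hull S) ↔ v ∈ S ∧ w ∈ S := by
  constructor
  · rintro ⟨-, he⟩
    rw [hull_pair] at he
    have hv := he.extremePoints_subset_extremePoints (left_mem_extremePoints_segment _ _)
    rw [segment_symm] at he
    have hw := he.extremePoints_subset_extremePoints (left_mem_extremePoints_segment _ _)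
    exact ⟨hS.mem_polygonVertices_hull.1 hv, hS.mem_polygonVertices_hull.1 hw⟩
  · rintro ⟨hv, hw⟩
    exact hS.isPolygonEdge_hull.2 ⟨v, hv, w, hw, hvw, rfl⟩

/-- Let `m` be the maximum of `n` on the second triangle. On the first, `n` is at least `m`, and it
exceeds `m` at the vertices that are not shared. So a common point has value `m` and lies in the
hull of the shared vertices. -/
theorem hull_inter_subset {n : Fin 3 → ℤ} {v w : Fin 24} {j k : Fin 8}
    (hn : Separates n (tri v j) (tri w k)) :
    hull (Finset.univ.image (tri v j)) ∩ hull (Finset.univ.image (tri w k)) ⊆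
      hull (Finset.univ.image (tri v j) ∩ Finset.univ.image (tri w k)) := by
  rintro p ⟨hp, hq⟩
  obtain ⟨b, hb⟩ := exists_basis_tri v j
  obtain ⟨c, hc⟩ := Finite.exists_max fun i => dot n (label (tri w k i))
  let l : E3 →ₗ[ℝ] ℝ := innerₗ E3 (toSpace n)
  have hl : ∀ v, l (point v) = dot n (label v) := fun v => inner_toSpace _ _
  have hle : l p ≤ dot n (label (tri w k c)) := by
    have hconv : Convex ℝ {x | l x ≤ dot n (label (tri w k c))} :=
      convex_halfSpace_le l.isLinear _
    refine convexHull_min ?_ hconv hq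
    rintro _ ⟨x, hx, rfl⟩
    obtain ⟨i, -, rfl⟩ := Finset.mem_image.1 hx
    simp only [Set.mem_ofPred_eq, hl]
    exact_mod_cast hc i
  have hpb : p ∈ convexHull ℝ (Set.range b) := by
    rw [hull, Finset.coe_image, Finset.coe_univ, Set.image_univ, ← Set.range_comp] at hp
    rwa [funext hb]
  have h := mem_convexHull_basis_image_of_le b l
    (I := {i | tri v j i ∈ Finset.univ.image (tri w k)})
    (fun i => by rw [hb, hl]; exact_mod_cast (hn i c).1) (fun i hi => ?_) hpb hle
  · refine convexHull_mono ?_ h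
    rintro _ ⟨i, hi, rfl⟩
    exact ⟨tri v j i, by simpa using hi, (hb i).symm⟩
  · rw [hb, hl]
    refine Int.cast_lt.2 ((hn i c).2.resolve_left ?_)
    rintro ⟨d, hd⟩
    exact hi (Finset.mem_image.2 ⟨d, Finset.mem_univ d, hd.symm⟩)

theorem hull_inter (hS : IsFace S) (hT : IsFace T) (hne : S ≠ T) :
    hull S ∩ hull T = hull (S ∩ T) := by
  refine Set.Subset.antisymm ?_ (Set.subset_inter ?_ ?_)
  · obtain ⟨v, j, h1, h2, rfl⟩ := hS.exists_tri
    obtain ⟨w, k, h3, h4, rfl⟩ := hT.exists_tri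
    obtain ⟨n, hn | hn⟩ := exists_separates_tri h1 h2 h3 h4
      (by rintro rfl rfl; exact hne rfl)
    · exact hull_inter_subset hn
    · rw [Set.inter_comm, Finset.inter_comm]
      exact hull_inter_subset hn
  · exact convexHull_mono (Set.image_mono (Finset.coe_subset.2 Finset.inter_subset_left))
  · exact convexHull_mono (Set.image_mono (Finset.coe_subset.2 Finset.inter_subset_right))

end IsFace

end FrickeKlein

/-! ### The faces form a closed connected surface -/

namespace FrickeKlein

namespace IsFace

variable {S T : Finset (Fin 24)}

theorem of_link_sub_one (v : Fin 24) (i : Fin 8) : IsFace {v, link v i, link v (i - 1)} := by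
  have h := of_link v (i - 1)
  rwa [sub_add_cancel, Finset.pair_comm] at h

/-- There are two faces at every edge. -/
theorem eq_or_eq (hS : IsFace S) {v w : Fin 24} (hv : v ∈ S) (hw : w ∈ S) (hvw : v ≠ w) :
    ∃ i, link v i = w ∧
      (S = {v, link v i, link v (i + 1)} ∨ S = {v, link v i, link v (i - 1)}) := by
  obtain ⟨j, rfl⟩ := hS.exists_link hv
  rw [Finset.mem_insert, Finset.mem_insert, Finset.mem_singleton] at hw
  obtain rfl | rfl | rfl := hw
  · exact absurd rfl hvw
  · exact ⟨j, rfl, Or.inl rfl⟩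
  · exact ⟨j + 1, rfl, Or.inr (by rw [add_sub_cancel_right, Finset.pair_comm])⟩

theorem link_ne_link (v : Fin 24) (i : Fin 8) :
    ({v, link v i, link v (i + 1)} : Finset (Fin 24)) ≠ {v, link v i, link v (i - 1)} := by
  intro h
  have h1 : link v (i + 1) ∈ ({v, link v i, link v (i - 1)} : Finset (Fin 24)) := by
    rw [← h]; simp
  have key : ∀ i : Fin 8, i + 1 ≠ i ∧ i + 1 ≠ i - 1 := by decide
  rw [Finset.mem_insert, Finset.mem_insert, Finset.mem_singleton] at h1
  obtain h1 | h1 | h1 := h1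
  · exact link_ne v _ h1
  · exact (key i).1 (link_injective v h1)
  · exact (key i).2 (link_injective v h1)

end IsFace

theorem not_coplanar_of_link {v : Fin 24} {i : Fin 8} {s : Set E3} (h0 : point v ∈ s)
    (h1 : point (link v i) ∈ s) (h2 : point (link v (i + 1)) ∈ s)
    (h3 : point (link v (i - 1)) ∈ s) : ¬ Coplanar ℝ s := by
  intro hs
  have hlin := linearIndependent_toSpace
    (x := ![label (link v i) - label v, label (link v (i + 1)) - label v,
      label (link v (i - 1)) - label v]) (det_adjacent_ne_zero v i)
  have hspan := finrank_span_eq_card hlin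
  have hle : Submodule.span ℝ (Set.range fun k => toSpace
      ((![label (link v i) - label v, label (link v (i + 1)) - label v,
        label (link v (i - 1)) - label v] : Fin 3 → Fin 3 → ℤ) k)) ≤ vectorSpan ℝ s := by
    have hsub : ∀ {w}, point w ∈ s → toSpace (label w - label v) ∈ vectorSpan ℝ s := by
      intro w hw
      rw [toSpace_sub]
      exact vsub_mem_vectorSpan ℝ hw h0
    rw [Submodule.span_le]
    rintro _ ⟨k, rfl⟩
    fin_cases k
    · exact hsub h1
    · exact hsub h2
    · exact hsub h3
  have h := (Submodule.finrank_mono hle).trans hs.finrank_le_two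
  rw [hspan] at h
  simp at h

def faceSet : Set (Set E3) := hull '' {S | IsFace S}

def Adjacent (F G : Set E3) : Prop :=
  F ∈ faceSet ∧ G ∈ faceSet ∧ ∃ e, IsPolygonEdge e F ∧ IsPolygonEdge e G

def AdjacentAt (x : E3) (F G : Set E3) : Prop :=
  F ∈ faceSet ∧ G ∈ faceSet ∧ ∃ e, x ∈ e ∧ IsPolygonEdge e F ∧ IsPolygonEdge e G

theorem Adjacent.symm {F G : Set E3} (h : Adjacent F G) : Adjacent G F :=
  ⟨h.2.1, h.1, h.2.2.imp fun _ he => he.symm⟩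

theorem faceSet_inter {F G : Set E3} (hF : F ∈ faceSet) (hG : G ∈ faceSet) (hFG : F ≠ G) :
    F ∩ G = ∅ ∨ (∃ v, v ∈ polygonVertices F ∧ v ∈ polygonVertices G ∧ F ∩ G = {v}) ∨
      (IsPolygonEdge (F ∩ G) F ∧ IsPolygonEdge (F ∩ G) G) := by
  obtain ⟨S, hS, rfl⟩ := hF
  obtain ⟨T, hT, rfl⟩ := hG
  have hne : S ≠ T := fun h => hFG (h ▸ rfl)
  rw [hS.hull_inter hT hne]
  have hcard : (S ∩ T).card < 3 := by
    rw [← hS.card_eq]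
    refine Finset.card_lt_card (Finset.inter_subset_left.ssubset_of_ne fun h => hne ?_)
    exact Finset.eq_of_subset_of_card_le (Finset.inter_eq_left.1 h)
      (hT.card_eq.trans hS.card_eq.symm).le
  have hcases : (S ∩ T).card = 0 ∨ (S ∩ T).card = 1 ∨ (S ∩ T).card = 2 := by omega
  obtain h | h | h := hcases
  · rw [Finset.card_eq_zero.1 h]
    left
    simp [hull]
  · obtain ⟨v, hv⟩ := Finset.card_eq_one.1 h
    have hm : v ∈ S ∩ T := by rw [hv]; simp
    rw [hv]
    exact Or.inr (Or.inl ⟨point v, hS.mem_polygonVertices_hull.2 (Finset.mem_inter.1 hm).1,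
      hT.mem_polygonVertices_hull.2 (Finset.mem_inter.1 hm).2, by simp [hull]⟩)
  · obtain ⟨v, w, hvw, h⟩ := Finset.card_eq_two.1 h
    have hv : v ∈ S ∩ T := by rw [h]; simp
    have hw : w ∈ S ∩ T := by rw [h]; simp
    rw [Finset.mem_inter] at hv hw
    rw [h]
    exact Or.inr (Or.inr ⟨(hS.isPolygonEdge_hull_pair hvw).2 ⟨hv.1, hw.1⟩,
      (hT.isPolygonEdge_hull_pair hvw).2 ⟨hv.2, hw.2⟩⟩)

theorem faceSet_existsUnique_adj {F : Set E3} (hF : F ∈ faceSet) {e : Set E3}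
    (he : IsPolygonEdge e F) : ∃! G, G ∈ faceSet ∧ G ≠ F ∧ IsPolygonEdge e G := by
  obtain ⟨S, hS, rfl⟩ := hF
  obtain ⟨v, hv, w, hw, hvw, rfl⟩ := hS.isPolygonEdge_hull.1 he
  obtain ⟨i, rfl, hSi⟩ := hS.eq_or_eq hv hw hvw
  -- Symmetric in the two faces at the edge, since the given face may be either of them.
  have main : ∀ S' T' : Finset (Fin 24), IsFace S' → IsFace T' → S' ≠ T' →
      v ∈ T' → link v i ∈ T' →
      (∀ U, IsFace U → v ∈ U → link v i ∈ U → U = S' ∨ U = T') →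
      ∃! G, G ∈ faceSet ∧ G ≠ hull S' ∧ IsPolygonEdge (hull {v, link v i}) G := by
    intro S' T' hS' hT' hne h1 h2 h3
    refine ⟨hull T', ⟨⟨T', hT', rfl⟩, fun h => hne (hT'.hull_injective hS' h).symm,
      (hT'.isPolygonEdge_hull_pair hvw).2 ⟨h1, h2⟩⟩, ?_⟩
    rintro _ ⟨⟨U, hU, rfl⟩, hUS, hUe⟩
    rw [hU.isPolygonEdge_hull_pair hvw] at hUe
    rcases h3 U hU hUe.1 hUe.2 with rfl | rfl
    · exact absurd rfl hUS
    · rfl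
  have hU : ∀ U, IsFace U → v ∈ U → link v i ∈ U →
      U = {v, link v i, link v (i + 1)} ∨ U = {v, link v i, link v (i - 1)} := by
    intro U hU h1 h2
    obtain ⟨k, hk, h⟩ := hU.eq_or_eq h1 h2 hvw
    rwa [link_injective v hk] at h
  rcases hSi with rfl | rfl
  · exact main _ _ hS (IsFace.of_link_sub_one v i) (IsFace.link_ne_link v i) (by simp) (by simp) hU
  · exact main _ _ hS (IsFace.of_link v i) (IsFace.link_ne_link v i).symm (by simp) (by simp)
      fun U h h1 h2 => (hU U h h1 h2).symm

/-- Consecutive faces around a vertex share an edge at it, so one walks around the link in steps of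
one. -/
theorem faceSet_vertex_link {x : E3} {F G : Set E3} (hF : F ∈ faceSet) (hG : G ∈ faceSet)
    (hxF : x ∈ polygonVertices F) (hxG : x ∈ polygonVertices G) :
    Relation.ReflTransGen (AdjacentAt x) F G := by
  obtain ⟨S, hS, rfl⟩ := hF
  obtain ⟨T, hT, rfl⟩ := hG
  rw [IsFace.polygonVertices_hull hS] at hxF
  obtain ⟨v, hv, rfl⟩ := hxF
  obtain ⟨i, rfl⟩ := IsFace.exists_link hS hv
  obtain ⟨j, rfl⟩ := IsFace.exists_link hT ((IsFace.mem_polygonVertices_hull hT).1 hxG)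
  have key : ∀ n : ℕ, Relation.ReflTransGen (AdjacentAt (point v))
      (hull {v, link v i, link v (i + 1)})
      (hull {v, link v (i + Fin.ofNat 8 n), link v (i + Fin.ofNat 8 n + 1)}) := by
    intro n
    induction n with
    | zero => simpa using Relation.ReflTransGen.refl
    | succ n ih =>
      refine ih.tail ?_
      have e : i + Fin.ofNat 8 (n + 1) = i + Fin.ofNat 8 n + 1 := by
        rw [add_assoc]; congr 1; ext; simp [Fin.val_add]
      rw [e]
      have hne : v ≠ link v (i + Fin.ofNat 8 n + 1) := (link_ne v _).symm
      refine ⟨⟨_, IsFace.of_link v _, rfl⟩, ⟨_, IsFace.of_link v _, rfl⟩,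
        hull {v, link v (i + Fin.ofNat 8 n + 1)}, ?_, ?_, ?_⟩
      · exact subset_convexHull ℝ _ (Set.mem_image_of_mem _ (by simp))
      · exact ((IsFace.of_link v _).isPolygonEdge_hull_pair hne).2 ⟨by simp, by simp⟩
      · exact ((IsFace.of_link v _).isPolygonEdge_hull_pair hne).2 ⟨by simp, by simp⟩
  have h := key (j - i).val
  have e : i + Fin.ofNat 8 (j - i).val = j := by simp
  rwa [e] at h

/-- One turns around a vertex to a face with a smaller neighbour, and descends in this way to a
fixed face at `0`. -/
theorem faceSet_connected {F G : Set E3} (hF : F ∈ faceSet) (hG : G ∈ faceSet) :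
    Relation.ReflTransGen Adjacent F G := by
  have hat : ∀ {v S T}, IsFace S → IsFace T → v ∈ S → v ∈ T →
      Relation.ReflTransGen Adjacent (hull S) (hull T) := by
    intro v S T hS hT h1 h2
    refine Relation.ReflTransGen.mono ?_ _ _ (faceSet_vertex_link ⟨S, hS, rfl⟩ ⟨T, hT, rfl⟩
      (hS.mem_polygonVertices_hull.2 h1) (hT.mem_polygonVertices_hull.2 h2))
    rintro A B ⟨hA, hB, e, -, h⟩
    exact ⟨hA, hB, e, h⟩
  have key : ∀ v : Fin 24, ∀ S, IsFace S → v ∈ S →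
      Relation.ReflTransGen Adjacent (hull S) (hull {0, link 0 0, link 0 (0 + 1)}) := by
    intro v
    induction v using WellFoundedLT.induction with
    | ind v ih =>
      intro S hS hv
      by_cases h0 : v = 0
      · subst h0
        exact hat hS (IsFace.of_link 0 0) hv (by simp)
      · obtain ⟨i, hi⟩ := exists_link_lt v h0
        exact (hat hS (IsFace.of_link v i) hv (by simp)).trans
          (ih _ hi _ (IsFace.of_link v i) (by simp))
  have hall : ∀ F ∈ faceSet, Relation.ReflTransGen Adjacent F
      (hull {0, link 0 0, link 0 (0 + 1)}) := by
    rintro _ ⟨S, hS, rfl⟩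
    obtain ⟨v, a, b, -, rfl⟩ := id hS
    exact key v _ hS (by simp)
  have : Std.Symm Adjacent := ⟨fun _ _ h => h.symm⟩
  exact (hall F hF).trans (symm (hall G hG))

theorem faceSet_not_coplanar {F G : Set E3} (hF : F ∈ faceSet) (hG : G ∈ faceSet) (hFG : F ≠ G)
    (h : ∃ e, IsPolygonEdge e F ∧ IsPolygonEdge e G) : ¬ Coplanar ℝ (F ∪ G) := by
  obtain ⟨S, hS, rfl⟩ := hF
  obtain ⟨T, hT, rfl⟩ := hG
  obtain ⟨e, heS, heT⟩ := h
  obtain ⟨v, hv, w, hw, hvw, rfl⟩ := hS.isPolygonEdge_hull.1 heS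
  obtain ⟨hv', hw'⟩ := (hT.isPolygonEdge_hull_pair hvw).1 heT
  obtain ⟨i, rfl, hSi⟩ := hS.eq_or_eq hv hw hvw
  obtain ⟨k, hk, hTi⟩ := hT.eq_or_eq hv' hw' hvw
  rw [link_injective v hk] at hTi
  have hsub : ∀ x, x ∈ S ∪ T → point x ∈ hull S ∪ hull T := by
    intro x hx
    rcases Finset.mem_union.1 hx with hx | hx
    · exact Or.inl (subset_convexHull ℝ _ (Set.mem_image_of_mem _ hx))
    · exact Or.inr (subset_convexHull ℝ _ (Set.mem_image_of_mem _ hx))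
  have hne : S ≠ T := fun h => hFG (h ▸ rfl)
  rcases hSi with rfl | rfl <;> rcases hTi with rfl | rfl
  · exact absurd rfl hne
  · exact not_coplanar_of_link (hsub v (by simp)) (hsub (link v i) (by simp))
      (hsub (link v (i + 1)) (by simp)) (hsub (link v (i - 1)) (by simp))
  · exact not_coplanar_of_link (hsub v (by simp)) (hsub (link v i) (by simp))
      (hsub (link v (i + 1)) (by simp)) (hsub (link v (i - 1)) (by simp))
  · exact absurd rfl hne

/-- The polyhedral embedding of the Fricke-Klein map in which every vertex is placed at its
label. -/
def polyhedron : Polyhedron where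
  faces := faceSet
  faces_finite := (Set.toFinite _).image _
  faces_nonempty := ⟨_, _, IsFace.of_link 0 0, rfl⟩
  isConvexPolygon := by
    rintro _ ⟨S, hS, rfl⟩
    exact hS.isConvexPolygon_hull
  inter _ hF _ hG := faceSet_inter hF hG
  existsUnique_adj _ hF _ := faceSet_existsUnique_adj hF
  vertex_link _ _ hF _ hG := faceSet_vertex_link hF hG
  connected _ hF _ hG := faceSet_connected hF hG
  not_coplanar _ hF _ hG := faceSet_not_coplanar hF hG

/-! ### The embedding and its symmetry group -/

theorem mem_faceSet {F : Set E3} :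
    F ∈ faceSet ↔ ∃ f ∈ frickeKleinMap, F = convexHull ℝ (toSpace '' (f : Set (Fin 3 → ℤ))) := by
  have h : ∀ v a b, hull {v, a, b} = convexHull ℝ (toSpace ''
      (({label v, label a, label b} : Finset (Fin 3 → ℤ)) : Set (Fin 3 → ℤ))) := by
    intro v a b
    simp [hull, Set.image_insert_eq, point]
  constructor
  · rintro ⟨_, ⟨v, a, b, hf, rfl⟩, rfl⟩
    exact ⟨_, mem_frickeKleinMap.2 ⟨v, a, b, hf, rfl⟩, h v a b⟩
  · rintro ⟨f, hf, rfl⟩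
    obtain ⟨v, a, b, h', rfl⟩ := mem_frickeKleinMap.1 hf
    exact ⟨_, ⟨v, a, b, h', rfl⟩, h v a b⟩

theorem isEmbeddingOf_polyhedron : polyhedron.IsEmbeddingOf frickeKleinMap := by
  refine ⟨toSpace, toSpace_injective.injOn, ?_⟩
  have hv : ∀ v a b, Flag v a b → polygonVertices (hull {v, a, b}) = toSpace ''
      (({label v, label a, label b} : Finset (Fin 3 → ℤ)) : Set (Fin 3 → ℤ)) := by
    intro v a b hf
    rw [IsFace.polygonVertices_hull ⟨v, a, b, hf, rfl⟩]
    simp [Set.image_insert_eq, point]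
  ext s
  constructor
  · rintro ⟨_, ⟨_, ⟨v, a, b, hf, rfl⟩, rfl⟩, rfl⟩
    exact ⟨_, mem_frickeKleinMap.2 ⟨v, a, b, hf, rfl⟩, (hv v a b hf).symm⟩
  · rintro ⟨f, hf, rfl⟩
    obtain ⟨v, a, b, h', rfl⟩ := mem_frickeKleinMap.1 hf
    exact ⟨_, ⟨_, ⟨v, a, b, h', rfl⟩, rfl⟩, hv v a b h'⟩

theorem image_mem_frickeKleinMap {f : Finset (Fin 3 → ℤ)} (hf : f ∈ frickeKleinMap)
    {p : Equiv.Perm (Fin 3)} {s : Fin 3 → ℤˣ} (h : Equiv.Perm.sign p * ∏ i, s i = 1) :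
    f.image (signedPerm p s) ∈ frickeKleinMap := by
  obtain ⟨q, t, hq, u, hu, rfl⟩ := hf
  -- The composite sends `x` to the point with coordinates `s i * t (p i) * x (q (p i))`.
  refine ⟨q * p, fun i => s i * t (p i), ?_, u, hu, ?_⟩
  · rw [Finset.prod_mul_distrib, Equiv.prod_comp p t, Equiv.Perm.sign_mul, ← one_mul (1 : ℤˣ)]
    nth_rw 1 [← hq]
    nth_rw 1 [← h]
    simp only [mul_comm, mul_left_comm, mul_assoc]
  · rw [Finset.image_image]
    congr 1
    funext x i
    simp [signedPerm, mul_assoc]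

theorem image_mem_faceSet {F : Set E3} (hF : F ∈ faceSet) {g : Isom3}
    (hg : g ∈ octahedralRotationGroup) : g '' F ∈ faceSet := by
  obtain ⟨p, s, rfl⟩ := Octahedron.exists_signedIsom hg.1
  obtain ⟨f, hf, rfl⟩ := mem_faceSet.1 hF
  refine mem_faceSet.2 ⟨_, image_mem_frickeKleinMap hf
    (Octahedron.signedIsom_mem_rotationGroup.1 hg), ?_⟩
  have h : ∀ x, Octahedron.signedIsom p s (toSpace x) = toSpace (signedPerm p s x) := by
    intro x
    ext i
    rw [Octahedron.signedIsom_apply, toSpace_apply, toSpace_apply, signedPerm]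
    push_cast
    rfl
  rw [Finset.coe_image, Set.image_image, ← funext h,
    ← Set.image_image (Octahedron.signedIsom p s) toSpace]
  exact AffineMap.image_convexHull (Octahedron.signedIsom p s).toAffineEquiv.toAffineMap _

theorem rotationGroup_le_symmetryGroup :
    octahedralRotationGroup ≤ polyhedron.symmetryGroup := by
  intro g hg F
  refine ⟨fun h => ?_, fun h => image_mem_faceSet h hg⟩
  have h' := image_mem_faceSet h (octahedralRotationGroup.inv_mem hg)
  have hid : ∀ x, (g⁻¹ : Isom3) (g x) = x := g.symm_apply_apply
  rwa [Set.image_image, funext hid, Set.image_id'] at h'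

/-- The rotation group is contained in the symmetry group and its order 24 already attains the
general bound. -/
theorem symmetryGroup_polyhedron : polyhedron.symmetryGroup = octahedralRotationGroup := by
  have h := isEmbeddingOf_polyhedron.card_symmetryGroup_le
  have := h.1
  refine (Subgroup.eq_of_le_of_card_ge rotationGroup_le_symmetryGroup ?_).symm
  rw [Octahedron.card_octahedralRotationGroup]
  exact h.2

end FrickeKlein

theorem mainTheorem4 :
    -- octahedral rotation symmetry occurs
    (∃ P : Polyhedron, P.IsEmbeddingOf frickeKleinMap ∧
      P.symmetryGroup = octahedralRotationGroup) ∧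
    -- no embedding has a larger symmetry group
    (Nat.card octahedralRotationGroup = 24 ∧
      ∀ P : Polyhedron, P.IsEmbeddingOf frickeKleinMap →
        Finite P.symmetryGroup ∧ Nat.card P.symmetryGroup ≤ 24) ∧
    -- no embedding has full octahedral symmetry
    (∀ P : Polyhedron, P.IsEmbeddingOf frickeKleinMap →
      ∀ h : Isom3, ¬ fullOctahedralGroupAt h ≤ P.symmetryGroup) ∧
    -- in particular, none of the candidate vertex arrangements does occur with this symmetry
    (∀ P : Polyhedron, P.IsEmbeddingOf frickeKleinMap →
      ∀ (h : Isom3) (S : Set E3), IsCandidateVertexSet S → P.vertices = h '' S →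
        ¬ fullOctahedralGroupAt h ≤ P.symmetryGroup) := by
  exact ⟨⟨FrickeKlein.polyhedron, FrickeKlein.isEmbeddingOf_polyhedron,
      FrickeKlein.symmetryGroup_polyhedron⟩,
    ⟨Octahedron.card_octahedralRotationGroup, fun P hP => hP.card_symmetryGroup_le⟩,
    fun P hP h => hP.not_fullOctahedralGroupAt_le h,
    fun P hP h _ _ _ => hP.not_fullOctahedralGroupAt_le h⟩
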